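/- Let $M$ be a complex manifold (Hausdorff, second countable, of complex dimension $n$; for example a smooth projective variety) with a holomorphic $\mathbb C^\times$-action and a Kähler form $\omega$ invariant under $S^1\subset\mathbb C^\times$. Let $L\subset M$ be an embedded Lagrangian submanifold with $\lambda L\subset L$ for all $\lambda\in S^1$. Let $E=\bigl(M\times(\mathbb C^2\setminus\{0\})\bigr)/\mathbb C^\times$ be the associated bundle, where $\lambda\cdot(x,(z_1,z_2))=(\lambda x,(\lambda z_1,\lambda z_2))$, with projection $\pi\colon E\to\mathbb P^1$, $[x,(z_1,z_2)]\mapsto[z_1:z_2]$, and let $c_1^{\rm vert}(E)$ be the first Chern class of the vertical tangent bundle $T_{\rm vert}E=\operatorname{Ker}(d\pi\colon TE\to\pi^*T\mathbb P^1)$. Let $u\colon\mathbb D=\{|z|\le 1\}\to M$ be a continuous disc whose boundary is an $S^1$-orbit on $L$, that is, $u(e^{i\theta})=e^{i\theta}\cdot u(1)$ for all $\theta$ and $u(1)\in L$. Let $\sigma(u)\colon\mathbb P^1\to E$ be given by $\sigma(u)([z:1])=[u(1),(z,1)]$ for $|z|\le1$ and $\sigma(u)([1:w])=[u(w),(1,w)]$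 for $|w|\le1$. Then: (1) $u(\partial\mathbb D)\subset L$, so that $u$ is a disc $(\mathbb D,\partial\mathbb D)\to(M,L)$ and defines a class in $\pi_2(M,L)$, and $\sigma(u)$ is a (well-defined) continuous section of $E\to\mathbb P^1$; (2) the Maslov index $\mu(u)$ and the vertical Chern number $\langle c_1^{\rm vert}(E),[\sigma(u)]\rangle=\deg\bigl(\sigma(u)^*T_{\rm vert}E\bigr)$ are well-defined integers, and $$\mu(u)=2\,\langle c_1^{\rm vert}(E),[\sigma(u)]\rangle .$$ Here $\mu(u)$ is the winding number along $\partial\mathbb D$ of $\det(A)^2/|\det(A)|^2$, where $A(z)$ is the matrix of a real basis of $T_{u(z)}L$ in a continuous complex frame of $u^*TM$ over $\mathbb D$; and the degree of a complex vector bundle on $\mathbb P^1$ is the winding number, along $|z|=1$ counterclockwise in $z=z_1/z_2$, of the determinant of a frame over $\{|z|\ge1\}\cup\{\infty\}$ expressed in a frame over $\{|z|\le1\}$ (so that $\mathcal O(1)$ has degree $1$). -/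

import Mathlib

open scoped Manifold ContDiff Topology
open Set

noncomputable section

section Glue

variable {𝕜 : Type*} [NontriviallyNormedField 𝕜] {E : Type*} [NormedAddCommGroup E]
  [NormedSpace 𝕜 E] {H : Type*} [TopologicalSpace H] {I : ModelWithCorners 𝕜 E H}
  {Y : Type*} [TopologicalSpace Y] [ChartedSpace H Y] {X : Type*} [TopologicalSpace X]

open Classical in
/-- The atlas on `X` obtained from two partial homeomorphisms `φ`, `ψ` onto open subsets of a
manifold `Y`, whose domains cover `X`: the charts are `φ` and `ψ` followed by charts of `Y`. -/
@[reducible] def gluedChartedSpace (φ ψ : OpenPartialHomeomorph X Y)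
    (h : ∀ x, x ∈ φ.source ∨ x ∈ ψ.source) : ChartedSpace H X :=
  letI : ChartedSpace Y X :=
    { atlas := {φ, ψ}
      chartAt := fun x => if x ∈ φ.source then φ else ψ
      mem_chart_source := fun x => by
        by_cases hx : x ∈ φ.source
        · simp [hx]
        · simpa [hx] using (h x).resolve_left hx
      chart_mem_atlas := fun x => by
        by_cases hx : x ∈ φ.source <;> simp [hx] }
  ChartedSpace.comp H Y X

theorem glued_isManifold {n : ℕ∞ω} [IsManifold I n Y] (φ ψ : OpenPartialHomeomorph X Y)
    (h : ∀ x, x ∈ φ.source ∨ x ∈ ψ.source)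
    (h₁ : ContMDiffOn I I n (φ.symm.trans ψ) (φ.symm.trans ψ).source)
    (h₂ : ContMDiffOn I I n (ψ.symm.trans φ) (ψ.symm.trans φ).source) :
    @IsManifold 𝕜 _ E _ _ H _ I n X _ (gluedChartedSpace φ ψ h) := by
  let _ : ChartedSpace H X := gluedChartedSpace φ ψ h
  have key : ∀ a ∈ ({φ, ψ} : Set (OpenPartialHomeomorph X Y)), ∀ b ∈
      ({φ, ψ} : Set (OpenPartialHomeomorph X Y)),
      ContMDiffOn I I n (a.symm.trans b) (a.symm.trans b).source := by
    have hid : ∀ a : OpenPartialHomeomorph X Y,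
        ContMDiffOn I I n (a.symm.trans a) (a.symm.trans a).source := fun a => by
      refine contMDiffOn_id.congr fun y hy => ?_
      simp only [mfld_simps] at hy ⊢
      exact a.right_inv hy.1
    rintro a (rfl | rfl) b (rfl | rfl)
    exacts [hid _, h₁, h₂, hid _]
  refine isManifold_of_contDiffOn I n X ?_
  rintro _ _ ⟨a, ha, c, hc, rfl⟩ ⟨b, hb, d, hd, rfl⟩
  have hc' := IsManifold.subset_maximalAtlas (I := I) (n := n) hc
  have hd' := IsManifold.subset_maximalAtlas (I := I) (n := n) hd
  have hmain : ContMDiffOn I I n (d ∘ (a.symm.trans b) ∘ c.symm)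
      ((a.trans c).symm.trans (b.trans d)).source := by
    refine (contMDiffOn_of_mem_maximalAtlas hd').comp
      ((key a ha b hb).comp ((contMDiffOn_symm_of_mem_maximalAtlas hc').mono ?_) ?_) ?_
    · intro y hy; simp only [mfld_simps] at hy ⊢; exact hy.1.1
    · intro y hy; simp only [mfld_simps] at hy ⊢; exact ⟨hy.1.2, hy.2.1⟩
    · intro y hy; simp only [mfld_simps] at hy ⊢; exact hy.2.2
  have := (contMDiffOn_iff.1 hmain).2
  by_cases hne : Nonempty H
  · obtain ⟨y₀⟩ := hne
    refine (this y₀ y₀).congr_mono (fun y hy => ?_) (fun y hy => ?_)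
    · simp only [mfld_simps, chartAt_self_eq]
    · simp only [mfld_simps, chartAt_self_eq] at hy ⊢
      exact ⟨hy.2, hy.1⟩
  · exact fun y _ => (hne ⟨I.symm y⟩).elim

end Glue

/-- The punctured plane `ℂ² ∖ {0}`. -/
def PuncturedPlane : Type := {v : ℂ × ℂ // v ≠ 0}

namespace PuncturedPlane

instance : TopologicalSpace PuncturedPlane := inferInstanceAs (TopologicalSpace {v : ℂ × ℂ // v ≠ 0})

/-- Scalar multiplication `λ · (z₁, z₂) = (λ z₁, λ z₂)`. -/
instance : MulAction ℂˣ PuncturedPlane where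
  smul c v := ⟨((c : ℂ) * v.1.1, (c : ℂ) * v.1.2), fun h => v.2 (by
    simpa [Prod.ext_iff] using h)⟩
  one_smul v := Subtype.ext (by ext <;> exact one_mul _)
  mul_smul a b v := Subtype.ext (by ext <;> exact mul_assoc _ _ _)

/-- The first coordinate. -/
def fst (v : PuncturedPlane) : ℂ := v.1.1
/-- The second coordinate. -/
def snd (v : PuncturedPlane) : ℂ := v.1.2

/-- The denominator of the affine coordinate: `den false = z₂` and `den true = z₁`. -/
def den (i : Bool) (v : PuncturedPlane) : ℂ := if i then v.fst else v.snd
/-- The numerator of the affine coordinate: `num false = z₁` and `num true = z₂`. -/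
def num (i : Bool) (v : PuncturedPlane) : ℂ := if i then v.snd else v.fst
/-- The vector with a given affine coordinate: `aff false z = (z, 1)` and `aff true z = (1, z)`. -/
def aff (i : Bool) (z : ℂ) : PuncturedPlane :=
  if i then ⟨(1, z), by simp⟩ else ⟨(z, 1), by simp⟩

@[simp] theorem fst_smul (c : ℂˣ) (v : PuncturedPlane) : (c • v).fst = c * v.fst := rfl
@[simp] theorem snd_smul (c : ℂˣ) (v : PuncturedPlane) : (c • v).snd = c * v.snd := rfl
@[simp] theorem den_smul (i : Bool) (c : ℂˣ) (v : PuncturedPlane) :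
    (c • v).den i = c * v.den i := by cases i <;> rfl
@[simp] theorem num_smul (i : Bool) (c : ℂˣ) (v : PuncturedPlane) :
    (c • v).num i = c * v.num i := by cases i <;> rfl
@[simp] theorem den_aff (i : Bool) (z : ℂ) : (aff i z).den i = 1 := by cases i <;> rfl
@[simp] theorem num_aff (i : Bool) (z : ℂ) : (aff i z).num i = z := by cases i <;> rfl
@[simp] theorem den_not (i : Bool) (v : PuncturedPlane) : v.den (!i) = v.num i := by
  cases i <;> rfl
@[simp] theorem num_not (i : Bool) (v : PuncturedPlane) : v.num (!i) = v.den i := by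
  cases i <;> rfl

theorem ext_aff (i : Bool) {v w : PuncturedPlane} (h₁ : v.num i = w.num i)
    (h₂ : v.den i = w.den i) : v = w := by
  cases i
  · exact Subtype.ext (Prod.ext h₁ h₂)
  · exact Subtype.ext (Prod.ext h₂ h₁)

theorem den_ne_or_den_ne (v : PuncturedPlane) : v.den false ≠ 0 ∨ v.den true ≠ 0 := by
  by_contra! h
  exact v.2 (Prod.ext h.2 h.1)

theorem continuous_fst : Continuous fst := _root_.continuous_fst.comp continuous_subtype_val
theorem continuous_snd : Continuous snd := _root_.continuous_snd.comp continuous_subtype_val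
theorem continuous_den (i : Bool) : Continuous (den i) := by
  cases i
  exacts [continuous_snd, continuous_fst]
theorem continuous_num (i : Bool) : Continuous (num i) := by
  cases i
  exacts [continuous_fst, continuous_snd]
theorem continuous_aff (i : Bool) : Continuous (aff i) := by
  cases i <;> exact Continuous.subtype_mk (by fun_prop) _

instance : ContinuousConstSMul ℂˣ PuncturedPlane where
  continuous_const_smul _ := Continuous.subtype_mk
    ((continuous_const.mul continuous_fst).prodMk (continuous_const.mul continuous_snd)) _

end PuncturedPlane

open PuncturedPlane

/-- The complex projective line `(ℂ² ∖ {0}) / ℂˣ`, with the quotient topology. -/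
def ProjLine : Type := MulAction.orbitRel.Quotient ℂˣ PuncturedPlane

instance : TopologicalSpace ProjLine :=
  inferInstanceAs (TopologicalSpace (MulAction.orbitRel.Quotient ℂˣ PuncturedPlane))

/-- The bundle `(X × (ℂ² ∖ {0})) / ℂˣ` associated to an action of `ℂˣ` on `X`, where `ℂˣ` acts
diagonally, with the quotient topology. -/
def AssocBundle (X : Type*) [MulAction ℂˣ X] : Type _ :=
  MulAction.orbitRel.Quotient ℂˣ (X × PuncturedPlane)

instance (X : Type*) [TopologicalSpace X] [MulAction ℂˣ X] : TopologicalSpace (AssocBundle X) :=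
  inferInstanceAs (TopologicalSpace (MulAction.orbitRel.Quotient ℂˣ (X × PuncturedPlane)))

/-- A nonzero complex number as a unit (and `0` is sent to `1`). -/
def toUnit (z : ℂ) : ℂˣ := if h : z = 0 then 1 else Units.mk0 z h

theorem coe_toUnit {z : ℂ} (h : z ≠ 0) : (toUnit z : ℂ) = z := by simp [toUnit, h]

theorem toUnit_mul (c : ℂˣ) {z : ℂ} (h : z ≠ 0) : toUnit (c * z) = c * toUnit z := by
  ext; rw [coe_toUnit (by simp [h]), Units.val_mul, coe_toUnit h]

@[simp] theorem toUnit_one : toUnit 1 = 1 := by ext; rw [coe_toUnit one_ne_zero]; rfl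

theorem contMDiffOn_toUnit {n : ℕ∞ω} : ContMDiffOn 𝓘(ℂ, ℂ) 𝓘(ℂ, ℂ) n toUnit {z | z ≠ 0} := by
  have h := contMDiffOn_chart_symm (I := 𝓘(ℂ, ℂ)) (n := n) (x := (1 : ℂˣ)) (H := ℂ)
  have ht : ∀ z : ℂ, z ≠ 0 → z ∈ (chartAt ℂ (1 : ℂˣ)).target := fun z hz => by
    have := (chartAt ℂ (1 : ℂˣ)).map_source (x := Units.mk0 z hz) (by simp)
    simpa [Units.chartAt_apply] using this
  refine (h.mono fun z hz => ht z hz).congr fun z hz => ?_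
  ext
  rw [coe_toUnit hz]
  exact ((chartAt ℂ (1 : ℂˣ)).right_inv (ht z hz)).symm

theorem continuousOn_toUnit : ContinuousOn toUnit {z | z ≠ 0} :=
  (contMDiffOn_toUnit (n := 0)).continuousOn

namespace ProjLine

/-- The point `[z₁ : z₂]`. -/
def mk (v : PuncturedPlane) : ProjLine := Quotient.mk _ v

theorem mk_eq_mk {v w : PuncturedPlane} : mk v = mk w ↔ ∃ c : ℂˣ, c • w = v :=
  Quotient.eq.trans Iff.rfl

theorem isOpenQuotientMap_mk : IsOpenQuotientMap mk := MulAction.isOpenQuotientMap_quotientMk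

/-- A representative of a point of the projective line. -/
def rep (p : ProjLine) : PuncturedPlane := Quotient.out p

@[simp] theorem mk_rep (p : ProjLine) : mk p.rep = p := Quotient.out_eq p

theorem rep_mk (v : PuncturedPlane) : ∃ c : ℂˣ, (mk v).rep = c • v := by
  obtain ⟨c, hc⟩ := mk_eq_mk.1 (mk_rep (mk v))
  exact ⟨c, hc.symm⟩

/-- The affine coordinates `z₁ / z₂` on `{z₂ ≠ 0}` (for `i = false`) and `z₂ / z₁` on `{z₁ ≠ 0}`
(for `i = true`). -/
def coord (i : Bool) : OpenPartialHomeomorph ProjLine ℂ where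
  toFun p := p.rep.num i / p.rep.den i
  invFun z := mk (aff i z)
  source := {p | p.rep.den i ≠ 0}
  target := univ
  map_source' _ _ := mem_univ _
  map_target' z _ := by
    obtain ⟨c, hc⟩ := rep_mk (aff i z)
    simp [hc]
  left_inv' p hp := by
    conv_rhs => rw [← mk_rep p]
    have hp' : p.rep.den i ≠ 0 := hp
    refine mk_eq_mk.2 ⟨(toUnit (p.rep.den i))⁻¹, ext_aff i ?_ ?_⟩
    · simp [coe_toUnit hp', div_eq_inv_mul]
    · simp [coe_toUnit hp', hp']
  right_inv' z _ := by
    obtain ⟨c, hc⟩ := rep_mk (aff i z)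
    simp [hc]
  open_source := by
    rw [← isOpenQuotientMap_mk.isQuotientMap.isOpen_preimage]
    convert (isOpen_ne (x := (0 : ℂ))).preimage (continuous_den i) using 1
    ext v
    obtain ⟨c, hc⟩ := rep_mk v
    simp [hc]
  open_target := isOpen_univ
  continuousOn_toFun := by
    have hs : mk ⁻¹' {p | p.rep.den i ≠ 0} = {v | v.den i ≠ 0} := by
      ext v
      obtain ⟨c, hc⟩ := rep_mk v
      simp [hc]
    have ho : IsOpen {p : ProjLine | p.rep.den i ≠ 0} := by
      rw [← isOpenQuotientMap_mk.isQuotientMap.isOpen_preimage, hs]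
      exact (isOpen_ne (x := (0 : ℂ))).preimage (continuous_den i)
    refine (isOpenQuotientMap_mk.isQuotientMap.continuousOn_isOpen_iff ho).2 ?_
    rw [hs]
    refine ((continuous_num i).continuousOn.div (continuous_den i).continuousOn
      fun v hv => hv).congr fun v _ => ?_
    obtain ⟨c, hc⟩ := rep_mk v
    simp [hc, mul_div_mul_left]
  continuousOn_invFun := (isOpenQuotientMap_mk.continuous.comp (continuous_aff i)).continuousOn

theorem mem_coord_source (p : ProjLine) : p ∈ (coord false).source ∨ p ∈ (coord true).source :=
  den_ne_or_den_ne p.rep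

theorem coord_symm_trans (i : Bool) {z : ℂ} (hz : z ∈ ((coord i).symm.trans (coord (!i))).source) :
    z ≠ 0 ∧ ((coord i).symm.trans (coord (!i))) z = z⁻¹ := by
  obtain ⟨c, hc⟩ := rep_mk (aff i z)
  have h : (mk (aff i z)).rep.den (!i) ≠ 0 := hz.2
  change _ ∧ (mk (aff i z)).rep.num (!i) / (mk (aff i z)).rep.den (!i) = _
  simp_all
  field_simp

instance : ChartedSpace ℂ ProjLine := gluedChartedSpace (coord false) (coord true) mem_coord_source

theorem contMDiffOn_coord_symm_trans (n : ℕ∞ω) (i : Bool) :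
    ContMDiffOn 𝓘(ℂ, ℂ) 𝓘(ℂ, ℂ) n ((coord i).symm.trans (coord (!i)))
      ((coord i).symm.trans (coord (!i))).source :=
  ((contDiffOn_inv ℂ).contMDiffOn.mono fun _ hz => (coord_symm_trans i hz).1).congr
    fun _ hz => (coord_symm_trans i hz).2

instance : IsManifold 𝓘(ℂ, ℂ) ω ProjLine :=
  glued_isManifold _ _ mem_coord_source (contMDiffOn_coord_symm_trans ω false) (contMDiffOn_coord_symm_trans ω true)

end ProjLine

namespace AssocBundle

variable {X : Type*} [MulAction ℂˣ X]

/-- The point `[x, (z₁, z₂)]`. -/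
def mk (q : X × PuncturedPlane) : AssocBundle X := Quotient.mk _ q

theorem mk_eq_mk {q r : X × PuncturedPlane} : mk q = mk r ↔ ∃ c : ℂˣ, c • r = q :=
  Quotient.eq.trans Iff.rfl

/-- A representative of a point of the associated bundle. -/
def rep (p : AssocBundle X) : X × PuncturedPlane := Quotient.out p

@[simp] theorem mk_rep (p : AssocBundle X) : mk p.rep = p := Quotient.out_eq p

theorem rep_mk (q : X × PuncturedPlane) : ∃ c : ℂˣ, (mk q).rep = c • q := by
  obtain ⟨c, hc⟩ := mk_eq_mk.1 (mk_rep (mk q))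
  exact ⟨c, hc.symm⟩

/-- The projection `π [x, (z₁, z₂)] = [z₁ : z₂]`. -/
def proj : AssocBundle X → ProjLine :=
  Quotient.lift (fun q => ProjLine.mk q.2) fun _ _ ⟨c, hc⟩ =>
    ProjLine.mk_eq_mk.2 ⟨c, congrArg Prod.snd hc⟩

@[simp] theorem proj_mk (q : X × PuncturedPlane) : proj (mk q) = ProjLine.mk q.2 := rfl

theorem mk_preimage_den (i : Bool) : (mk : X × PuncturedPlane → AssocBundle X) ⁻¹'
    {p | p.rep.2.den i ≠ 0} = {q | q.2.den i ≠ 0} := by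
  ext q
  obtain ⟨c, hc⟩ := rep_mk q
  simp [hc]

variable [TopologicalSpace X] [ContinuousSMul ℂˣ X]

theorem isOpenQuotientMap_mk : IsOpenQuotientMap (mk : X × PuncturedPlane → AssocBundle X) :=
  MulAction.isOpenQuotientMap_quotientMk

theorem isOpen_den (i : Bool) : IsOpen {p : AssocBundle X | p.rep.2.den i ≠ 0} := by
  rw [← isOpenQuotientMap_mk.isQuotientMap.isOpen_preimage, mk_preimage_den]
  exact (isOpen_ne (x := (0 : ℂ))).preimage ((continuous_den i).comp _root_.continuous_snd)

variable (X) in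
/-- The two trivializations of the associated bundle: `[x, (z₁, z₂)] ↦ (z₂⁻¹ x, z₁ / z₂)` over
`{z₂ ≠ 0}` (for `i = false`) with inverse `(x, z) ↦ [x, (z, 1)]`, and
`[x, (z₁, z₂)] ↦ (z₁⁻¹ x, z₂ / z₁)` over `{z₁ ≠ 0}` (for `i = true`) with inverse
`(x, w) ↦ [x, (1, w)]`. -/
def triv (i : Bool) : OpenPartialHomeomorph (AssocBundle X) (X × ℂ) where
  toFun p := ((toUnit (p.rep.2.den i))⁻¹ • p.rep.1, p.rep.2.num i / p.rep.2.den i)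
  invFun y := mk (y.1, aff i y.2)
  source := {p | p.rep.2.den i ≠ 0}
  target := univ
  map_source' _ _ := mem_univ _
  map_target' y _ := by
    obtain ⟨c, hc⟩ := rep_mk (y.1, aff i y.2)
    simp [hc]
  left_inv' p hp := by
    conv_rhs => rw [← mk_rep p]
    have hp' : p.rep.2.den i ≠ 0 := hp
    refine mk_eq_mk.2 ⟨(toUnit (p.rep.2.den i))⁻¹, Prod.ext rfl (ext_aff i ?_ ?_)⟩
    · simp [coe_toUnit hp', div_eq_inv_mul]
    · simp [coe_toUnit hp', hp']
  right_inv' y _ := by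
    obtain ⟨c, hc⟩ := rep_mk (y.1, aff i y.2)
    have := toUnit_mul c one_ne_zero
    simp_all
  open_source := isOpen_den i
  open_target := isOpen_univ
  continuousOn_toFun := by
    refine (isOpenQuotientMap_mk.isQuotientMap.continuousOn_isOpen_iff (isOpen_den i)).2 ?_
    rw [mk_preimage_den]
    have hden : ContinuousOn (fun q : X × PuncturedPlane => q.2.den i) {q | q.2.den i ≠ 0} :=
      ((continuous_den i).comp _root_.continuous_snd).continuousOn
    have hnum : ContinuousOn (fun q : X × PuncturedPlane => q.2.num i) {q | q.2.den i ≠ 0} :=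
      ((continuous_num i).comp _root_.continuous_snd).continuousOn
    refine ContinuousOn.congr (f := fun q : X × PuncturedPlane =>
      ((toUnit (q.2.den i))⁻¹ • q.1, q.2.num i / q.2.den i)) ?_ fun q hq => ?_
    · exact (((continuousOn_toUnit.comp hden fun q hq => hq).inv).smul
        _root_.continuous_fst.continuousOn).prodMk (hnum.div hden fun q hq => hq)
    · obtain ⟨c, hc⟩ := rep_mk q
      have := toUnit_mul c (show q.2.den i ≠ 0 from hq)
      simp [hc, this, mul_div_mul_left, smul_smul]
  continuousOn_invFun := (isOpenQuotientMap_mk.continuous.comp (_root_.continuous_fst.prodMk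
    ((continuous_aff i).comp _root_.continuous_snd))).continuousOn

theorem mem_triv_source (p : AssocBundle X) :
    p ∈ (triv X false).source ∨ p ∈ (triv X true).source :=
  den_ne_or_den_ne p.rep.2

theorem triv_symm_trans (i : Bool) {y : X × ℂ}
    (hy : y ∈ ((triv X i).symm.trans (triv X (!i))).source) :
    y.2 ≠ 0 ∧ ((triv X i).symm.trans (triv X (!i))) y = ((toUnit y.2)⁻¹ • y.1, y.2⁻¹) := by
  obtain ⟨c, hc⟩ := rep_mk (y.1, aff i y.2)
  have h : (mk (y.1, aff i y.2)).rep.2.den (!i) ≠ 0 := hy.2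
  have hy2 : y.2 ≠ 0 := by simp_all
  have := toUnit_mul c hy2
  refine ⟨hy2, ?_⟩
  change ((toUnit ((mk (y.1, aff i y.2)).rep.2.den (!i)))⁻¹ • (mk (y.1, aff i y.2)).rep.1,
    (mk (y.1, aff i y.2)).rep.2.num (!i) / (mk (y.1, aff i y.2)).rep.2.den (!i)) = _
  simp [hc, this, smul_smul]
  field_simp

end AssocBundle

section Manifold

variable {V : Type*} [NormedAddCommGroup V] [NormedSpace ℂ V]
  {X : Type*} [TopologicalSpace X] [ChartedSpace V X] [MulAction ℂˣ X] 

instance AssocBundle.instChartedSpace [ContinuousSMul ℂˣ X] : ChartedSpace (ModelProd V ℂ) (AssocBundle X) :=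
  gluedChartedSpace (AssocBundle.triv X false) (AssocBundle.triv X true) AssocBundle.mem_triv_source

theorem AssocBundle.contMDiffOn_triv_symm_trans {n : ℕ∞ω} [ContinuousSMul ℂˣ X]
    [ContMDiffSMul 𝓘(ℂ, ℂ) 𝓘(ℂ, V) n ℂˣ X] (i : Bool) :
    ContMDiffOn (𝓘(ℂ, V).prod 𝓘(ℂ, ℂ)) (𝓘(ℂ, V).prod 𝓘(ℂ, ℂ)) n
      ((triv X i).symm.trans (triv X (!i))) ((triv X i).symm.trans (triv X (!i))).source := by
  refine ContMDiffOn.congr (f := fun y : X × ℂ => ((toUnit y.2)⁻¹ • y.1, y.2⁻¹)) ?_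
    fun y hy => (triv_symm_trans i hy).2
  refine ContMDiffOn.mono (s := {y : X × ℂ | y.2 ≠ 0}) ?_ fun y hy => (triv_symm_trans i hy).1
  have h2 : ContMDiffOn (𝓘(ℂ, V).prod 𝓘(ℂ, ℂ)) 𝓘(ℂ, ℂ) n (fun y : X × ℂ => y.2) {y | y.2 ≠ 0} :=
    contMDiff_snd.contMDiffOn
  have h3 := (contMDiffOn_toUnit (n := n)).comp h2 fun y hy => hy
  refine ContMDiffOn.prodMk ?_ ((contDiffOn_inv ℂ).contMDiffOn.comp h2 fun y hy => hy)
  have h4 := h3.inv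
  exact (contMDiff_smul (I := 𝓘(ℂ, ℂ)) (I' := 𝓘(ℂ, V)) (n := n) (G := ℂˣ) (M := X)).comp_contMDiffOn
    (h4.prodMk contMDiff_fst.contMDiffOn)

instance AssocBundle.instIsManifold [ContinuousSMul ℂˣ X] [IsManifold 𝓘(ℂ, V) ω X]
    [ContMDiffSMul 𝓘(ℂ, ℂ) 𝓘(ℂ, V) ω ℂˣ X] :
    IsManifold (𝓘(ℂ, V).prod 𝓘(ℂ, ℂ)) ω (AssocBundle X) :=
  glued_isManifold _ _ mem_triv_source (contMDiffOn_triv_symm_trans false) (contMDiffOn_triv_symm_trans true)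

end Manifold

section Frames

variable {E : Type*} [NormedAddCommGroup E] [NormedSpace ℂ E] {H : Type*} [TopologicalSpace H]
  (I : ModelWithCorners ℂ E H) {X : Type*} [TopologicalSpace X] [ChartedSpace H X]
  [IsManifold I 1 X]

/-- A continuous complex frame, with `n` members, of the pullback `f^*W` of a complex subbundle `W`
of the tangent bundle of `X` along a map `f : Z → X`. -/
structure ComplexFrame (W : ∀ x : X, Submodule ℂ (TangentSpace I x)) (n : ℕ)
    {Z : Type*} [TopologicalSpace Z] (f : Z → X) where
  /-- The basis of the fibre of `f^*W` at `z`. -/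
  basis : ∀ z : Z, Module.Basis (Fin n) ℂ (W (f z))
  /-- The members of the frame are continuous sections. -/
  continuous_basis : ∀ j : Fin n,
    Continuous fun z : Z => (⟨f z, (basis z j : TangentSpace I (f z))⟩ : TangentBundle I X)

/-- `k` is the winding number around `0` of the loop `f` in `ℂ ∖ {0}`: there is a continuous
logarithm `φ` of `t ↦ f (e^{it})`, and `φ (2π) - φ 0 = 2πik`. -/
def HasWindingNumber (f : Circle → ℂ) (k : ℤ) : Prop :=
  ∃ φ : ℝ → ℂ, Continuous φ ∧ (∀ t, Complex.exp (φ t) = f (Circle.exp t)) ∧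
    φ (2 * Real.pi) - φ 0 = 2 * Real.pi * Complex.I * k

namespace ProjLine

/-- The disc `D₀ = {|z| ≤ 1}` in the projective line, where `z = z₁ / z₂`. -/
def discZero : Set ProjLine := {p | ∃ z : ℂ, ‖z‖ ≤ 1 ∧ p = mk (aff false z)}

/-- The disc `D_∞ = {|z| ≥ 1} ∪ {∞}` in the projective line, where `z = z₁ / z₂`. -/
def discInfty : Set ProjLine := {p | ∃ w : ℂ, ‖w‖ ≤ 1 ∧ p = mk (aff true w)}

/-- The point `z` of the common boundary `|z| = 1` of `D₀` and `D_∞`. -/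
def ofCircle (z : Circle) : ProjLine := mk (aff false z)

theorem ofCircle_mem_discZero (z : Circle) : ofCircle z ∈ discZero :=
  ⟨z, (Circle.norm_coe z).le, rfl⟩

theorem ofCircle_mem_discInfty (z : Circle) : ofCircle z ∈ discInfty := by
  refine ⟨(z⁻¹ : Circle), (Circle.norm_coe _).le, mk_eq_mk.2 ⟨Circle.toUnits z, ext_aff false ?_ ?_⟩⟩
  · change (z : ℂ) * 1 = z
    simp
  · change (z : ℂ) * (z⁻¹ : Circle) = 1
    simp

end ProjLine

/-- `k` is the value of the first Chern class of the complex subbundle `W`, of rank `n`, of the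
tangent bundle of `X` on the homology class of the sphere `f : ℙ¹ → X`, that is, the degree of
the complex vector bundle `f^*W` on `ℙ¹`. It is the winding number along `|z| = 1`
(counterclockwise in the coordinate `z`) of the determinant of a frame of `f^*W` on `D_∞` with
respect to a frame of `f^*W` on `D₀`. With this sign `𝒪(1)` has degree `1`. -/
def HasChernNumber (W : ∀ x : X, Submodule ℂ (TangentSpace I x)) (n : ℕ) (f : ProjLine → X)
    (k : ℤ) : Prop :=
  ∃ (a : ComplexFrame I W n fun p : ProjLine.discZero => f p)
    (b : ComplexFrame I W n fun p : ProjLine.discInfty => f p),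
    HasWindingNumber (fun z =>
      (a.basis ⟨ProjLine.ofCircle z, ProjLine.ofCircle_mem_discZero z⟩).det
        (b.basis ⟨ProjLine.ofCircle z, ProjLine.ofCircle_mem_discInfty z⟩)) k

open Classical in
/-- The value of the first Chern class of `W` on the class of the sphere `f : ℙ¹ → X`. -/
def chernNumber (W : ∀ x : X, Submodule ℂ (TangentSpace I x)) (n : ℕ) (f : ProjLine → X) : ℤ :=
  if h : ∃ k, HasChernNumber I W n f k then h.choose else 0

end Frames

section Lagrangian

variable (V : Type*) [NormedAddCommGroup V] [NormedSpace ℂ V]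
  (M : Type*) [TopologicalSpace M] [ChartedSpace V M]

/-- The expression of a differential form of degree two on `M` in the chart at `x₀`. -/
def formInChart (η : ∀ x : M, TangentSpace 𝓘(ℂ, V) x [⋀^Fin 2]→L[ℝ] ℝ) (x₀ : M) (y : V) :
    V [⋀^Fin 2]→L[ℝ] ℝ :=
  (η ((chartAt V x₀).symm y)).compContinuousLinearMap
    ((mfderiv 𝓘(ℂ, V) 𝓘(ℂ, V) (chartAt V x₀).symm y).restrictScalars ℝ)

/-- A Kähler form on the complex manifold `M`: a smooth closed real form of degree two which is
invariant under the complex structure and positive. -/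
structure KahlerForm where
  /-- The form at each point. -/
  toFun : ∀ x : M, TangentSpace 𝓘(ℂ, V) x [⋀^Fin 2]→L[ℝ] ℝ
  smooth : ∀ x₀ : M, ContDiffOn ℝ ∞ (formInChart V M toFun x₀) (chartAt V x₀).target
  closed : ∀ x₀ : M, ∀ y ∈ (chartAt V x₀).target, extDeriv (formInChart V M toFun x₀) y = 0
  complex_invariant : ∀ (x : M) (v w : TangentSpace 𝓘(ℂ, V) x),
    toFun x ![Complex.I • v, Complex.I • w] = toFun x ![v, w]
  positive : ∀ (x : M) (v : TangentSpace 𝓘(ℂ, V) x), v ≠ 0 → 0 < toFun x ![v, Complex.I • v]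

variable {V M} {F : Type*} [NormedAddCommGroup F] [NormedSpace ℝ F]
  {L : Type*} [TopologicalSpace L] [ChartedSpace F L]

/-- Invariance of a Kähler form under the action of the unit circle. -/
def KahlerForm.IsCircleInvariant [MulAction ℂˣ M] (η : KahlerForm V M) : Prop :=
  ∀ (c : Circle) (x : M) (v w : TangentSpace 𝓘(ℂ, V) x),
    η.toFun (Circle.toUnits c • x)
      ![mfderiv 𝓘(ℂ, V) 𝓘(ℂ, V) (fun y : M => Circle.toUnits c • y) x v,
        mfderiv 𝓘(ℂ, V) 𝓘(ℂ, V) (fun y : M => Circle.toUnits c • y) x w] =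
    η.toFun x ![v, w]

/-- The tangent space at `y ∈ M` of the submanifold `ι : L → M`, as a set of tangent vectors of
`M` (empty if `y` is not on the submanifold). -/
def tangentPlane (V : Type*) [NormedAddCommGroup V] [NormedSpace ℂ V] [ChartedSpace V M]
    (F : Type*) [NormedAddCommGroup F] [NormedSpace ℝ F] [ChartedSpace F L]
    (ι : L → M) (y : M) : Set (TangentSpace 𝓘(ℂ, V) y) :=
  {v | (⟨y, v⟩ : TangentBundle 𝓘(ℝ, V) M) ∈ Set.range (tangentMap 𝓘(ℝ, F) 𝓘(ℝ, V) ι)}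

/-- `ι : L → M` is a Lagrangian submanifold of the Kähler manifold `(M, η)`: a smooth embedding,
`η` vanishes on the tangent spaces of `L`, and the real dimension of `L` is the complex dimension
of `M`. -/
structure IsLagrangian (η : KahlerForm V M) (ι : L → M) : Prop where
  isSmoothEmbedding : Manifold.IsSmoothEmbedding 𝓘(ℝ, F) 𝓘(ℝ, V) ∞ ι
  isotropic : ∀ (y : M), ∀ v ∈ tangentPlane V F ι y, ∀ w ∈ tangentPlane V F ι y,
    η.toFun y ![v, w] = 0
  finrank_eq : Module.finrank ℝ F = Module.finrank ℂ V

/-- The closed unit disc in `ℂ`. -/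
abbrev ClosedDisc : Type := Metric.closedBall (0 : ℂ) 1

/-- The inclusion of the unit circle into the closed unit disc. -/
def bdry (z : Circle) : ClosedDisc := ⟨z, mem_closedBall_zero_iff.2 (Circle.norm_coe z).le⟩

variable (V F) in
/-- `m` is the Maslov index of the disc `u : (𝔻, S¹) → (M, L)`: for a complex frame of `u^*TM` on
the disc, it is the winding number of `z ↦ (det A(z))² / |det A(z)|²`, where the columns of
`A(z)` are the coordinates, in that frame, of a real basis of the tangent space of `L` at `u(z)`,
for `|z| = 1` (this quotient does not depend on the real basis). -/
def HasMaslovIndex [IsManifold 𝓘(ℂ, V) 1 M] (ι : L → M) (u : C(ClosedDisc, M)) (m : ℤ) : Prop :=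
  (∀ z : Circle, u (bdry z) ∈ Set.range ι) ∧
  ∃ (a : ComplexFrame 𝓘(ℂ, V) (fun _ : M => ⊤) (Module.finrank ℂ V) u) (ρ : Circle → ℂ),
    (∀ (z : Circle) (b : Fin (Module.finrank ℂ V) → TangentSpace 𝓘(ℂ, V) (u (bdry z))),
      LinearIndependent ℝ b → (∀ j, b j ∈ tangentPlane V F ι (u (bdry z))) →
      ρ z = ((a.basis (bdry z)).det fun j => ⟨b j, trivial⟩) ^ 2 /
        (‖(a.basis (bdry z)).det fun j => ⟨b j, trivial⟩‖ : ℂ) ^ 2) ∧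
    HasWindingNumber ρ m

open Classical in
variable (V F) in
/-- The Maslov index of a disc `u : (𝔻, S¹) → (M, L)`. -/
def maslovIndex [IsManifold 𝓘(ℂ, V) 1 M] (ι : L → M) (u : C(ClosedDisc, M)) : ℤ :=
  if h : ∃ m, HasMaslovIndex V F ι u m then h.choose else 0

end Lagrangian

namespace AssocBundle

section Vertical

variable (V : Type*) [NormedAddCommGroup V] [NormedSpace ℂ V]
  {M : Type*} [TopologicalSpace M] [ChartedSpace V M] [MulAction ℂˣ M] [ContinuousSMul ℂˣ M]

/-- The vertical tangent bundle `Ker (dπ : TE → π^*Tℙ¹)` of the associated bundle `E`. -/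
def vertical (p : AssocBundle M) :
    Submodule ℂ (TangentSpace (𝓘(ℂ, V).prod 𝓘(ℂ, ℂ)) p) :=
  LinearMap.ker (mfderiv (𝓘(ℂ, V).prod 𝓘(ℂ, ℂ)) 𝓘(ℂ, ℂ) proj p).toLinearMap

end Vertical

section DiscSection

variable {M : Type*} [TopologicalSpace M] [MulAction ℂˣ M]

open Classical in
/-- The section `σ(u)` before passing to the quotient by `ℂˣ`. -/
def discSectionAux (u : C(ClosedDisc, M)) (v : PuncturedPlane) : AssocBundle M :=
  if h : ‖v.fst‖ ≤ ‖v.snd‖ then mk (toUnit v.snd • u (bdry 1), v)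
  else mk (toUnit v.fst • u ⟨v.snd / v.fst, by
    have h' : ‖v.snd‖ < ‖v.fst‖ := not_le.1 h
    simpa using div_le_one_of_le₀ h'.le (norm_nonneg _)⟩, v)

theorem discSectionAux_smul (u : C(ClosedDisc, M)) (c : ℂˣ) (v : PuncturedPlane) :
    discSectionAux u (c • v) = discSectionAux u v := by
  have hc : 0 < ‖(c : ℂ)‖ := norm_pos_iff.2 c.ne_zero
  have hiff : ‖(c • v).fst‖ ≤ ‖(c • v).snd‖ ↔ ‖v.fst‖ ≤ ‖v.snd‖ := by
    simp [hc]
  unfold discSectionAux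
  by_cases h : ‖v.fst‖ ≤ ‖v.snd‖
  · rw [dif_pos h, dif_pos (hiff.2 h)]
    have h0 : v.snd ≠ 0 := fun h0 => by
      have h1 : v.fst = 0 := by simpa [h0] using h
      exact (den_ne_or_den_ne v).elim (· h0) (· h1)
    exact mk_eq_mk.2 ⟨c, by simp [toUnit_mul c h0, mul_smul]⟩
  · rw [dif_neg h, dif_neg (mt hiff.1 h)]
    have h0 : v.fst ≠ 0 := fun h0 => h (by simp [h0])
    refine mk_eq_mk.2 ⟨c, ?_⟩
    simp [toUnit_mul c h0, mul_smul, mul_div_mul_left]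

/-- The section `σ(u) : ℙ¹ → E` defined by a disc `u` with `u(e^{iθ}) = e^{iθ} · u(1)`. -/
def discSection (u : C(ClosedDisc, M)) : ProjLine → AssocBundle M :=
  Quotient.lift (discSectionAux u) fun _ _ ⟨c, hc⟩ => hc ▸ discSectionAux_smul u c _

/-- Over `D₀` the section `σ(u)` is `z ↦ (u(1), z)` in the trivialization
`(x, z) ↦ [x, (z, 1)]`. -/
theorem discSection_zero (u : C(ClosedDisc, M)) {z : ℂ} (hz : ‖z‖ ≤ 1) :
    discSection u (ProjLine.mk (aff false z)) = mk (u (bdry 1), aff false z) := by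
  change discSectionAux u (aff false z) = _
  have h : ‖(aff false z).fst‖ ≤ ‖(aff false z).snd‖ := by
    change ‖z‖ ≤ ‖(1 : ℂ)‖
    simpa using hz
  rw [discSectionAux, dif_pos h]
  change mk (toUnit 1 • u (bdry 1), _) = _
  simp

/-- Over `D_∞` the section `σ(u)` is `w ↦ (u(w), w)` in the trivialization
`(x, w) ↦ [x, (1, w)]`, where `w = z⁻¹`. -/
theorem discSection_infty (u : C(ClosedDisc, M))
    (hu : ∀ z : Circle, u (bdry z) = Circle.toUnits z • u (bdry 1)) (w : ClosedDisc) :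
    discSection u (ProjLine.mk (aff true w)) = mk (u w, aff true w) := by
  change discSectionAux u (aff true w) = _
  have hw : ‖(w : ℂ)‖ ≤ 1 := mem_closedBall_zero_iff.1 w.2
  by_cases h : ‖(aff true w).fst‖ ≤ ‖(aff true w).snd‖
  · rw [discSectionAux, dif_pos h]
    have hw1 : ‖(w : ℂ)‖ = 1 := by
      have h' : ‖(1 : ℂ)‖ ≤ ‖(w : ℂ)‖ := h
      exact le_antisymm hw (by simpa using h')
    let c : Circle := ⟨w, by simpa [Submonoid.unitSphere] using hw1⟩
    have hc : bdry c = w := rfl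
    have hcu : Circle.toUnits c = toUnit (w : ℂ) := by
      ext
      rw [coe_toUnit (by intro h0; simp [h0] at hw1)]
      rfl
    rw [← hc, hu c, hcu]
    rfl
  · rw [discSectionAux, dif_neg h]
    have : (⟨(aff true (w : ℂ)).snd / (aff true (w : ℂ)).fst, by
      change (w : ℂ) / 1 ∈ _
      simpa using hw⟩ : ClosedDisc) = w :=
      Subtype.ext (div_one (w : ℂ))
    rw [this]
    change mk (toUnit 1 • u w, _) = _
    simp

end DiscSection

end AssocBundle

end

open scoped Manifold ContDiff Topology
open Set

noncomputable section

/-! ### Winding numbers of loops in the punctured plane -/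

section Winding

/-! Both integers are read off from the winding number of a single determinant. Choose a real basis
b of the tangent plane of L at u(1). The Kähler form vanishes on this plane and is positive on pairs
(v, iv), so the plane is totally real and b is also a complex basis of the tangent space of M
(`IsLagrangian.linearIndependent_complex`).

Over D₀ the section is constant, equal to u(1), in the first trivialization of E, so b gives a frame
of the pulled-back vertical bundle. Over D_∞ it is w ↦ u(w) in the second trivialization, so a frame
e of u^*TM gives a frame there. On the common circle w = z⁻¹, and the two descriptions of a fibre
differ by the action of z⁻¹ (`AssocBundle.fibreDeriv_false`). Hence the first frame has, in the
second one, the coordinates of the translates (z⁻¹)_* b in e(z⁻¹). The Chern number uses the inverse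
of this matrix, and replacing z⁻¹ by z reverses the circle. The two signs cancel, so the Chern
number is the winding number of the determinant of z_* b in e(z)
(`exists_hasChernNumber_discSection`).

The circle preserves L, so z_* b is a real basis of the tangent plane at u(z), and the same
determinant computes the Maslov index. Squaring and normalizing doubles its winding number
(`hasMaslovIndex_of_hasWindingNumber`).

Two facts support this. A frame e exists because a bundle on the disc is trivial: a basis over the
centre is carried outwards in small steps by approximate parallel transport
(`exists_continuous_frame_disc`). The integers do not depend on the frames because a change of frame
over a whole disc has a nowhere vanishing determinant there, which winds zero times around the
boundary (`hasWindingNumber_zero_of_disc`). -/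

/-- The exponential is a covering of the punctured plane, so maps from simply connected, locally
path connected spaces lift. -/
theorem exists_continuous_log {A : Type*} [TopologicalSpace A] [SimplyConnectedSpace A]
    [LocallyPathConnectedSpace A] {f : A → ℂ} (hf : Continuous f) (h0 : ∀ a, f a ≠ 0) :
    ∃ φ : A → ℂ, Continuous φ ∧ ∀ a, Complex.exp (φ a) = f a := by
  obtain ⟨a₀⟩ : Nonempty A := inferInstance
  obtain ⟨φ, ⟨-, hφ⟩, -⟩ := Complex.isCoveringMapOn_exp.existsUnique_continuousMap_lifts
    ⟨f, hf⟩ (a₀ := a₀) (Complex.exp_log (h0 a₀)) h0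
  exact ⟨φ, φ.continuous, fun a => congrFun hφ a⟩

theorem exists_hasWindingNumber {f : Circle → ℂ} (hf : Continuous f) (h0 : ∀ z, f z ≠ 0) :
    ∃ k, HasWindingNumber f k := by
  obtain ⟨φ, hφ, hexp⟩ := exists_continuous_log (hf.comp Circle.exp.continuous) fun t => h0 _
  have h : Complex.exp (φ (2 * Real.pi)) = Complex.exp (φ 0) := by
    rw [hexp, hexp]
    simp
  obtain ⟨k, hk⟩ := Complex.exp_eq_exp_iff_exists_int.1 h
  exact ⟨k, φ, hφ, hexp, by rw [hk]; ring⟩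

theorem HasWindingNumber.ne_zero {f : Circle → ℂ} {k : ℤ} (h : HasWindingNumber f k)
    (z : Circle) : f z ≠ 0 := by
  obtain ⟨φ, -, hexp, -⟩ := h
  rw [← Circle.exp_arg z, ← hexp]
  exact Complex.exp_ne_zero _

/-- Two logarithms of the same loop differ by a constant, since lifts through the covering `exp`
that agree at one point agree everywhere. -/
theorem HasWindingNumber.unique {f : Circle → ℂ} {k l : ℤ} (hk : HasWindingNumber f k)
    (hl : HasWindingNumber f l) : k = l := by
  obtain ⟨φ, hφ, hexp, hφk⟩ := hk
  obtain ⟨ψ, hψ, hexp', hψl⟩ := hl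
  -- The constant is chosen so that the lifts agree at 0; its exponential is 1 because both
  -- logarithms exponentiate to the same value there.
  have h : φ = fun t => ψ t + (φ 0 - ψ 0) := by
    refine Complex.isCoveringMap_exp.eq_of_comp_eq hφ (by fun_prop) (funext fun t => ?_) 0 (by ring)
    refine Subtype.ext ?_
    simp [Complex.exp_add, Complex.exp_sub, hexp, hexp']
    rw [div_self, mul_one]
    have := Complex.exp_ne_zero (φ 0)
    rwa [hexp, Circle.exp_zero] at this
  have h2 := congrFun h (2 * Real.pi)
  have h3 : (2 * Real.pi * Complex.I : ℂ) * k = 2 * Real.pi * Complex.I * l := by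
    rw [← hφk, ← hψl, h2]; ring
  exact_mod_cast mul_left_cancel₀ Complex.two_pi_I_ne_zero h3

theorem HasWindingNumber.mul {f g : Circle → ℂ} {k l : ℤ} (hk : HasWindingNumber f k)
    (hl : HasWindingNumber g l) : HasWindingNumber (fun z => f z * g z) (k + l) := by
  obtain ⟨φ, hφ, hexp, hφk⟩ := hk
  obtain ⟨ψ, hψ, hexp', hψl⟩ := hl
  refine ⟨fun t => φ t + ψ t, hφ.add hψ, fun t => by rw [Complex.exp_add, hexp, hexp'], ?_⟩
  push_cast
  linear_combination hφk + hψl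

theorem HasWindingNumber.inv {f : Circle → ℂ} {k : ℤ} (hk : HasWindingNumber f k) :
    HasWindingNumber (fun z => (f z)⁻¹) (-k) := by
  obtain ⟨φ, hφ, hexp, hφk⟩ := hk
  refine ⟨fun t => -φ t, hφ.neg, fun t => by rw [Complex.exp_neg, hexp], ?_⟩
  push_cast
  linear_combination -hφk

theorem HasWindingNumber.comp_inv {f : Circle → ℂ} {k : ℤ} (hk : HasWindingNumber f k) :
    HasWindingNumber (fun z => f z⁻¹) (-k) := by
  obtain ⟨φ, hφ, hexp, hφk⟩ := hk
  refine ⟨fun t => φ (2 * Real.pi - t), by fun_prop, fun t => ?_, ?_⟩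
  · rw [hexp, Circle.exp_sub, Circle.exp_two_pi, one_div]
  · push_cast
    simp only [sub_self, sub_zero]
    linear_combination -hφk

theorem HasWindingNumber.sq_div_norm_sq {f : Circle → ℂ} {k : ℤ} (hk : HasWindingNumber f k) :
    HasWindingNumber (fun z => f z ^ 2 / (‖f z‖ : ℂ) ^ 2) (2 * k) := by
  obtain ⟨φ, hφ, hexp, hφk⟩ := hk
  -- Subtracting twice the real part divides by the squared norm. It does not affect the increment,
  -- because 2πik is purely imaginary and so the real part of φ returns to its initial value.
  refine ⟨fun t => 2 * φ t - 2 * ((φ t).re : ℂ), by fun_prop, fun t => ?_, ?_⟩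
  · beta_reduce
    rw [Complex.exp_sub, ← hexp, Complex.norm_exp, ← Complex.exp_nat_mul, Complex.ofReal_exp,
      ← Complex.exp_nat_mul]
    norm_num
  · have h : (φ (2 * Real.pi)).re - (φ 0).re = 0 := by
      rw [← Complex.sub_re, hφk]
      simp
    have h' : ((φ (2 * Real.pi)).re : ℂ) - ((φ 0).re : ℂ) = 0 := by exact_mod_cast h
    push_cast
    linear_combination 2 * hφk - 2 * h'

/-- A retraction of the plane onto the closed unit disc. -/
def discRetraction (z : ℂ) : ClosedDisc :=
  ⟨((max 1 ‖z‖)⁻¹ : ℝ) * z, by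
    have h : (0 : ℝ) < max 1 ‖z‖ := lt_max_of_lt_left one_pos
    rw [mem_closedBall_zero_iff, norm_mul, Complex.norm_real, Real.norm_of_nonneg (by positivity),
      inv_mul_le_one₀ h]
    exact le_max_right _ _⟩

theorem continuous_discRetraction : Continuous discRetraction := by
  refine Continuous.subtype_mk ((Complex.continuous_ofReal.comp
    (Continuous.inv₀ (by fun_prop) fun z => ?_)).mul continuous_id) _
  exact (lt_max_of_lt_left one_pos).ne'

theorem discRetraction_coe (z : ClosedDisc) : discRetraction z = z := by
  have h : ‖(z : ℂ)‖ ≤ 1 := mem_closedBall_zero_iff.1 z.2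
  exact Subtype.ext (by simp [discRetraction, h])

/-- Precomposing with the retraction extends the function to the whole plane, where it has a
logarithm; restricted to the circle this logarithm is single-valued. -/
theorem hasWindingNumber_zero_of_disc {g : ClosedDisc → ℂ} (hg : Continuous g)
    (h0 : ∀ z, g z ≠ 0) : HasWindingNumber (fun z => g (bdry z)) 0 := by
  obtain ⟨φ, hφ, hexp⟩ := exists_continuous_log (hg.comp continuous_discRetraction) fun z => h0 _
  refine ⟨fun t => φ (Circle.exp t), hφ.comp (continuous_subtype_val.comp Circle.exp.continuous),
    fun t => ?_, by simp⟩
  rw [hexp, Function.comp_apply]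
  exact congrArg g (discRetraction_coe (bdry (Circle.exp t)))

end Winding

/-! ### Continuity of sections and of their coordinates in a frame -/

section BundleSections

open Bundle

variable {B : Type*} [TopologicalSpace B] {F : Type*} [NormedAddCommGroup F] [NormedSpace ℂ F]
  {E : B → Type*} [∀ x, AddCommGroup (E x)] [∀ x, Module ℂ (E x)]
  [TopologicalSpace (TotalSpace F E)] [∀ x, TopologicalSpace (E x)]
  [FiberBundle F E] [VectorBundle ℂ F E] {Z : Type*} [TopologicalSpace Z]

/-- Continuity is tested in one fixed trivialization. The linear form of the trivialization is used,
which is defined at every point of the base, so that sums and scalar multiples can be computed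
before restricting to a neighbourhood. -/
theorem continuousAt_section_iff (e : Trivialization F (π F E)) [MemTrivializationAtlas e]
    {f : Z → B} {s : ∀ z, E (f z)} {z₀ : Z} (h : f z₀ ∈ e.baseSet) :
    ContinuousAt (fun z => (⟨f z, s z⟩ : TotalSpace F E)) z₀ ↔
      ContinuousAt f z₀ ∧ ContinuousAt (fun z => e.linearMapAt ℂ (f z) (s z)) z₀ := by
  refine (e.tendsto_nhds_iff (e.mem_source.2 h)).trans (and_congr_right fun hf => ?_)
  have h1 : (fun z => (e ⟨f z, s z⟩).2) =ᶠ[𝓝 z₀] fun z => e.linearMapAt ℂ (f z) (s z) := by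
    filter_upwards [hf (e.open_baseSet.mem_nhds h)] with z hz
    rw [e.coe_linearMapAt_of_mem (b := f z) hz]
  rw [ContinuousAt, ← h1.eq_of_nhds]
  exact Filter.tendsto_congr' h1

theorem continuousAt_sum_section {f : Z → B} {z₀ : Z} (hf : ContinuousAt f z₀) {ι : Type*}
    (t : Finset ι) {s : ι → ∀ z, E (f z)}
    (hs : ∀ i ∈ t, ContinuousAt (fun z => (⟨f z, s i z⟩ : TotalSpace F E)) z₀) :
    ContinuousAt (fun z => (⟨f z, ∑ i ∈ t, s i z⟩ : TotalSpace F E)) z₀ := by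
  have h := mem_baseSet_trivializationAt F E (f z₀)
  refine (continuousAt_section_iff (trivializationAt F E (f z₀)) h).2 ⟨hf, ?_⟩
  simp only [map_sum]
  exact tendsto_finsetSum _ fun i hi => ((continuousAt_section_iff _ h).1 (hs i hi)).2

/-- The coordinates of a continuous section of `f^*W` in a continuous frame are continuous; here
for the determinant of `n` sections. -/
theorem continuous_det_section [FiniteDimensional ℂ F] {f : Z → B}
    (W : ∀ x, Submodule ℂ (E x)) {n : ℕ}
    (a : ∀ z, Module.Basis (Fin n) ℂ (W (f z)))
    (ha : ∀ j, Continuous fun z => (⟨f z, (a z j : E (f z))⟩ : TotalSpace F E))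
    (s : ∀ z, Fin n → W (f z))
    (hs : ∀ j, Continuous fun z => (⟨f z, (s z j : E (f z))⟩ : TotalSpace F E)) :
    Continuous fun z => (a z).det (s z) := by
  refine continuous_iff_continuousAt.2 fun z₀ => ?_
  set e := trivializationAt F E (f z₀) with he
  have h : f z₀ ∈ e.baseSet := mem_baseSet_trivializationAt F E (f z₀)
  let v : ∀ z, Fin n → F := fun z j => e.linearMapAt ℂ (f z) (a z j)
  let w : ∀ z, Fin n → F := fun z j => e.linearMapAt ℂ (f z) (s z j)
  have hv : ∀ j, ContinuousAt (fun z => v z j) z₀ := fun j =>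
    ((continuousAt_section_iff e h).1 (ha j).continuousAt).2
  have hw : ∀ j, ContinuousAt (fun z => w z j) z₀ := fun j =>
    ((continuousAt_section_iff e h).1 (hs j).continuousAt).2
  have hli : LinearIndependent ℂ (v z₀) := by
    have h1 : LinearIndependent ℂ fun j => (a z₀ j : E (f z₀)) :=
      (a z₀).linearIndependent.map' (W (f z₀)).subtype (Submodule.ker_subtype _)
    have h2 := h1.map' (e.linearEquivAt ℂ (f z₀) h).toLinearMap (LinearEquiv.ker _)
    have h3 : v z₀ = (e.linearEquivAt ℂ (f z₀) h).toLinearMap ∘ fun j => (a z₀ j : E (f z₀)) := by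
      ext j
      simp only [v, Function.comp_apply, LinearEquiv.coe_coe, e.linearMapAt_def_of_mem h]
    rw [h3]
    exact h2
  -- No local triviality of W is assumed. Instead a fixed left inverse P of the frame at z₀ turns
  -- vectors of the ambient fibre into n coordinates.
  obtain ⟨P, hP⟩ := LinearMap.exists_leftInverse_of_injective
    (Fintype.linearCombination ℂ (v z₀)) (LinearMap.ker_eq_bot.2
      hli.fintypeLinearCombination_injective)
  have hPc : Continuous P := P.continuous_of_finiteDimensional
  let D : Z → Matrix (Fin n) (Fin n) ℂ := fun z => Matrix.of fun i j => P (v z j) i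
  let D' : Z → Matrix (Fin n) (Fin n) ℂ := fun z => Matrix.of fun i j => P (w z j) i
  have hD : ContinuousAt D z₀ := continuousAt_pi.2 fun i => continuousAt_pi.2 fun j =>
    (continuous_apply i).continuousAt.comp (hPc.continuousAt.comp (hv j))
  have hD' : ContinuousAt D' z₀ := continuousAt_pi.2 fun i => continuousAt_pi.2 fun j =>
    (continuous_apply i).continuousAt.comp (hPc.continuousAt.comp (hw j))
  have hd : ContinuousAt (fun z => (D z).det) z₀ :=
    (continuous_id.matrix_det.continuousAt (x := D z₀)).comp hD
  have hd' : ContinuousAt (fun z => (D' z).det) z₀ :=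
    (continuous_id.matrix_det.continuousAt (x := D' z₀)).comp hD'
  have hD1 : D z₀ = 1 := by
    ext i j
    have := congrFun (LinearMap.congr_fun hP (Pi.single j 1)) i
    simpa [D, Matrix.one_apply, Pi.single_apply, Fintype.linearCombination_apply_single] using this
  have hd0 : (D z₀).det ≠ 0 := by simp [hD1]
  -- D and D' are the P-coordinates of the frame and of the sections. Near z₀ the matrix D is
  -- invertible, so the desired determinant is the quotient det D' / det D of continuous functions.
  have hmul : ∀ z, D' z = D z * (a z).toMatrix (s z) := fun z => by
    ext i j
    have h1 : (s z j : E (f z)) = ∑ k, (a z).toMatrix (s z) k j • (a z k : E (f z)) := by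
      have := congrArg (W (f z)).subtype ((a z).sum_toMatrix_smul_self (s z) j).symm
      rw [map_sum] at this
      exact this
    have h2 : w z j = ∑ k, (a z).toMatrix (s z) k j • v z k := by
      simp only [w, v]
      rw [h1]
      simp only [map_sum, map_smul]
    simp only [D', D, Matrix.of_apply, Matrix.mul_apply, h2, map_sum, map_smul]
    simp [mul_comm]
  refine (hd'.div hd hd0).congr ?_
  filter_upwards [hd.eventually_ne hd0] with z hz
  rw [Module.Basis.det_apply, Pi.div_apply, hmul z, Matrix.det_mul, mul_div_cancel_left₀ _ hz]

end BundleSections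

/-! ### Approximate parallel transport in a vector bundle -/

section Transport

open Bundle

variable {B : Type*} [TopologicalSpace B] {F : Type*} [NormedAddCommGroup F] [NormedSpace ℂ F]
  {E : B → Type*} [∀ x, AddCommGroup (E x)] [∀ x, Module ℂ (E x)]
  [TopologicalSpace (TotalSpace F E)] [∀ x, TopologicalSpace (E x)]
  [FiberBundle F E] [VectorBundle ℂ F E]

variable (F E) in
/-- On a compact base, there is a continuous family of linear maps `E x → E y` between the fibres
of a vector bundle, which are scalar multiples of the identity for `x = y`. -/
theorem exists_continuous_transport [CompactSpace B] [T2Space B] :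
    ∃ T : ∀ x y : B, E x →ₗ[ℂ] E y,
      (∀ {Z : Type _} [TopologicalSpace Z] (g h : Z → B) (s : ∀ z, E (g z)) (z₀ : Z),
        ContinuousAt (fun z => (⟨g z, s z⟩ : TotalSpace F E)) z₀ → ContinuousAt h z₀ →
        ContinuousAt (fun z => (⟨h z, T (g z) (h z) (s z)⟩ : TotalSpace F E)) z₀) ∧
      ∀ x, ∃ c : ℂ, c ≠ 0 ∧ ∀ v, T x x v = c • v := by
  classical
  let e : B → Trivialization F (π F E) := fun x => trivializationAt F E x
  obtain ⟨t, ht⟩ := isCompact_univ.elim_finite_subcover (fun x => (e x).baseSet)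
    (fun x => (e x).open_baseSet) fun x _ => mem_iUnion.2 ⟨x, mem_baseSet_trivializationAt F E x⟩
  obtain ⟨ρ, hρ⟩ := PartitionOfUnity.exists_isSubordinate isClosed_univ
    (fun i : t => (e i).baseSet) (fun i => (e i).open_baseSet) (by simpa [iUnion_subtype] using ht)
  -- Identify the two fibres by each trivialization and average with weights ρᵢ(x)ρᵢ(y), which
  -- vanish unless both points lie in the i-th base set. On the diagonal the result is
  -- multiplication by ∑ ρᵢ(x)² > 0.
  refine ⟨fun x y => ∑ i : t, ((ρ i x * ρ i y : ℝ) : ℂ) •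
    ((e i).symmₗ ℂ y ∘ₗ (e i).linearMapAt ℂ x), ?_, fun x => ?_⟩
  · intro Z _ g h s z₀ hs hh
    have hg : ContinuousAt g z₀ := (FiberBundle.continuous_proj F E).continuousAt.comp hs
    simp only [LinearMap.sum_apply]
    refine continuousAt_sum_section hh _ fun i _ => ?_
    -- If both points lie in the closed support, the i-th trivialization is available at both.
    -- Otherwise the weight vanishes near z₀ and the term is locally the zero section.
    by_cases hi : g z₀ ∈ tsupport (ρ i) ∧ h z₀ ∈ tsupport (ρ i)
    · have hgi := hρ i hi.1
      have hhi := hρ i hi.2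
      refine (continuousAt_section_iff (e i) hhi).2 ⟨hh, ?_⟩
      have h1 := ((continuousAt_section_iff (e i) hgi).1 hs).2
      have h2 : ContinuousAt (fun z => ((ρ i (g z) * ρ i (h z) : ℝ) : ℂ)) z₀ :=
        Complex.continuous_ofReal.continuousAt.comp
          (((ρ i).continuous.continuousAt.comp hg).mul ((ρ i).continuous.continuousAt.comp hh))
      refine (h2.smul h1).congr ?_
      filter_upwards [hh ((e i).open_baseSet.mem_nhds hhi)] with z hz
      simp only [LinearMap.smul_apply, LinearMap.comp_apply, map_smul, Pi.smul_apply']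
      rw [(e i).linearMapAt_symmₗ hz]
    · have h0 : ∀ᶠ z in 𝓝 z₀, ρ i (g z) * ρ i (h z) = 0 := by
        rcases not_and_or.1 hi with hi | hi
        · filter_upwards [hg ((isClosed_tsupport _).isOpen_compl.mem_nhds hi)] with z hz
          rw [image_eq_zero_of_notMem_tsupport hz, zero_mul]
        · filter_upwards [hh ((isClosed_tsupport _).isOpen_compl.mem_nhds hi)] with z hz
          rw [image_eq_zero_of_notMem_tsupport hz, mul_zero]
      refine ((Trivialization.continuous_zeroSection ℂ (F := F) (E := E)).continuousAt.comp
          hh).congr ?_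
      filter_upwards [h0] with z hz
      simp [hz, zeroSection]
  · refine ⟨∑ i : t, ((ρ i x * ρ i x : ℝ) : ℂ), ?_, fun v => ?_⟩
    · obtain ⟨i, hi⟩ := ρ.exists_pos (mem_univ x)
      rw [← Complex.ofReal_sum]
      exact Complex.ofReal_ne_zero.2 (Finset.sum_pos' (fun j _ => mul_self_nonneg (ρ j x))
        ⟨i, Finset.mem_univ _, mul_pos hi hi⟩).ne'
    · simp only [LinearMap.sum_apply, Finset.sum_smul, LinearMap.smul_apply, LinearMap.comp_apply]
      refine Finset.sum_congr rfl fun i _ => ?_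
      by_cases hi : x ∈ tsupport (ρ i)
      · rw [(e i).symmₗ_linearMapAt (hρ i hi)]
      · rw [image_eq_zero_of_notMem_tsupport hi]
        simp

/-- The maps of a continuous family which is a multiple of the identity on the diagonal are
injective near the diagonal. -/
theorem eventually_injective_transport [FiniteDimensional ℂ F] {T : ∀ x y : B, E x →ₗ[ℂ] E y}
    {x₀ : B}
    (hT : ∀ (s : ∀ p : B × B, E p.1),
        ContinuousAt (fun p => (⟨p.1, s p⟩ : TotalSpace F E)) (x₀, x₀) →
        ContinuousAt (fun p : B × B => (⟨p.2, T p.1 p.2 (s p)⟩ : TotalSpace F E)) (x₀, x₀))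
    (hc : ∃ c : ℂ, c ≠ 0 ∧ ∀ v, T x₀ x₀ v = c • v) :
    ∀ᶠ p : B × B in 𝓝 (x₀, x₀), Function.Injective (T p.1 p.2) := by
  set e := trivializationAt F E x₀
  have h : x₀ ∈ e.baseSet := mem_baseSet_trivializationAt F E x₀
  -- T read in a trivialization at x₀: a family of endomorphisms of one fixed space, continuous at
  -- (x₀, x₀), whose determinant is nonzero there.
  let A : B × B → F →ₗ[ℂ] F := fun p =>
    e.linearMapAt ℂ p.2 ∘ₗ T p.1 p.2 ∘ₗ e.symmₗ ℂ p.1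
  have hA : ∀ v, ContinuousAt (fun p : B × B => A p v) (x₀, x₀) := fun v => by
    refine ((continuousAt_section_iff e h).1 (hT (fun p => e.symmₗ ℂ p.1 v) ?_)).2
    refine (continuousAt_section_iff e h).2 ⟨continuousAt_fst, ?_⟩
    refine (continuousAt_const (y := v)).congr ?_
    filter_upwards [continuousAt_fst (e.open_baseSet.mem_nhds h)] with p hp
    rw [e.linearMapAt_symmₗ hp]
  let b := Module.finBasis ℂ F
  have hdet : ContinuousAt (fun p : B × B => (LinearMap.toMatrix b b (A p)).det) (x₀, x₀) := by
    have hd : Continuous (Matrix.det (R := ℂ) (n := Fin (Module.finrank ℂ F))) :=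
      continuous_id.matrix_det
    refine hd.continuousAt.comp (f := fun p => LinearMap.toMatrix b b (A p)) ?_
    refine continuousAt_pi.2 fun i => continuousAt_pi.2 fun j => ?_
    simp only [LinearMap.toMatrix_apply]
    exact ((b.coord i).continuous_of_finiteDimensional.continuousAt).comp (hA (b j))
  have h0 : (LinearMap.toMatrix b b (A (x₀, x₀))).det ≠ 0 := by
    obtain ⟨c, hc0, hc⟩ := hc
    have : A (x₀, x₀) = c • LinearMap.id := by
      refine LinearMap.ext fun v => ?_
      simp only [A, LinearMap.comp_apply, hc, map_smul, LinearMap.smul_apply, LinearMap.id_apply]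
      rw [e.linearMapAt_symmₗ h]
    rw [this]
    simp [hc0]
  filter_upwards [hdet.eventually_ne h0, continuousAt_fst (e.open_baseSet.mem_nhds h)] with p hp hp1
  have hinj : Function.Injective (A p) := by
    rw [LinearMap.det_toMatrix] at hp
    exact ((LinearMap.isUnit_iff_isUnit_det _).2 (isUnit_iff_ne_zero.2 hp) |>
      (Module.End.isUnit_iff _).1).1
  intro v w hvw
  -- Only the first point needs to lie in the base set: injectivity of A forces that of its middle
  -- factor T.
  have h1 : A p (e.linearMapAt ℂ p.1 v) = A p (e.linearMapAt ℂ p.1 w) := by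
    simp only [A, LinearMap.comp_apply, e.symmₗ_linearMapAt hp1, hvw]
  rw [← e.symmₗ_linearMapAt (R := ℂ) hp1 v, hinj h1, e.symmₗ_linearMapAt hp1]

end Transport

/-! ### Triviality of vector bundles on the disc -/

section DiscFrame

open Bundle

/-- Multiplication by a real number in `[0, 1]` on the closed disc. -/
def discScale (r : ℝ) (z : ClosedDisc) : ClosedDisc := discRetraction (r * z)

theorem continuous_discScale (r : ℝ) : Continuous (discScale r) :=
  continuous_discRetraction.comp (continuous_const.mul continuous_subtype_val)

theorem coe_discScale {r : ℝ} (h0 : 0 ≤ r) (h1 : r ≤ 1) (z : ClosedDisc) :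
    (discScale r z : ℂ) = r * z := by
  have h : ‖(r * z : ℂ)‖ ≤ 1 := by
    rw [norm_mul, Complex.norm_real, Real.norm_of_nonneg h0]
    exact mul_le_one₀ h1 (norm_nonneg _) (mem_closedBall_zero_iff.1 z.2)
  exact congrArg Subtype.val (discRetraction_coe ⟨r * z, mem_closedBall_zero_iff.2 h⟩)

variable {F : Type*} [NormedAddCommGroup F] [NormedSpace ℂ F] [FiniteDimensional ℂ F]
  (E : ClosedDisc → Type*) [∀ x, AddCommGroup (E x)] [∀ x, Module ℂ (E x)]
  [TopologicalSpace (TotalSpace F E)] [∀ x, TopologicalSpace (E x)]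
  [FiberBundle F E] [VectorBundle ℂ F E]

variable (F) in
/-- A complex vector bundle on the closed disc is trivial. -/
theorem exists_continuous_frame_disc :
    ∃ s : Fin (Module.finrank ℂ F) → ∀ z, E z,
      (∀ j, Continuous fun z => (⟨z, s j z⟩ : TotalSpace F E)) ∧
      ∀ z, LinearIndependent ℂ fun j => s j z := by
  obtain ⟨T, hT, hTd⟩ := exists_continuous_transport F E
  have hinj : {p : ClosedDisc × ClosedDisc | Function.Injective (T p.1 p.2)} ∈
      𝓝ˢ (diagonal ClosedDisc) := by
    refine mem_nhdsSet_iff_forall.2 ?_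
    rintro ⟨x, y⟩ (rfl : x = y)
    exact eventually_injective_transport (F := F)
      (fun s hs => hT Prod.fst Prod.snd s _ hs continuousAt_snd) (hTd x)
  rw [nhdsSet_diagonal_eq_uniformity] at hinj
  -- By compactness, neighbourhoods of the diagonal are entourages, so transport is injective
  -- between any two points at distance less than a uniform δ.
  obtain ⟨δ, hδ, hinj⟩ := Metric.mem_uniformity_dist.1 hinj
  obtain ⟨N, hN⟩ := exists_nat_one_div_lt hδ
  -- Induction along the contraction of the disc, in N + 1 steps of size 1/(N + 1) < δ. The map g is
  -- kept as a variable with an equation because the fibres E (g z) depend on it: at k = 0 it is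
  -- replaced by a constant map and at k = N + 1 by the identity.
  have key : ∀ k : ℕ, k ≤ N + 1 → ∀ g : ClosedDisc → ClosedDisc, g = discScale (k / (N + 1)) →
      ∃ s : Fin (Module.finrank ℂ F) → ∀ z, E (g z),
      (∀ j, Continuous fun z => (⟨g z, s j z⟩ : TotalSpace F E)) ∧
      ∀ z, LinearIndependent ℂ fun j => s j z := by
    intro k
    induction k with
    | zero =>
      intro _ g hg
      obtain ⟨x, rfl⟩ : ∃ x, g = fun _ => x :=
        ⟨discRetraction 0, by rw [hg]; funext z; simp [discScale]⟩
      let b := (Module.finBasis ℂ F).map (VectorBundle.continuousLinearEquivAt ℂ F E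
          x).symm.toLinearEquiv
      exact ⟨fun j _ => b j, fun j => continuous_const, fun _ => b.linearIndependent⟩
    | succ k ih =>
      intro hk g hg
      obtain ⟨s, hs, hli⟩ := ih (Nat.le_of_succ_le hk) _ rfl
      refine ⟨fun j z => T _ (g z) (s j z), fun j => continuous_iff_continuousAt.2 fun z =>
        hT _ g _ z (hs j).continuousAt ?_, fun z => ?_⟩
      · exact hg ▸ (continuous_discScale _).continuousAt
      -- Consecutive scalings move z by at most ‖z‖/(N + 1) < δ, so transport keeps the frame
      -- independent.
      · have hdist : dist (discScale (k / (N + 1)) z) (discScale ((k + 1 : ℕ) / (N + 1)) z) < δ :=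
            ?_
        · exact (hli z).map' (T _ (g z)) (LinearMap.ker_eq_bot.2 (hinj (hg ▸ hdist)))
        have hN0 : (0 : ℝ) < N + 1 := by positivity
        have hk' : ((k + 1 : ℕ) : ℝ) ≤ N + 1 := by exact_mod_cast hk
        have hk'' : (k : ℝ) ≤ N + 1 := by exact_mod_cast Nat.le_of_succ_le hk
        rw [Subtype.dist_eq, coe_discScale (r := k / (N + 1)) (by positivity)
          ((div_le_one₀ hN0).2 hk''), coe_discScale (r := (k + 1 : ℕ) / (N + 1)) (by positivity)
          ((div_le_one₀ hN0).2 hk'), dist_eq_norm, ← sub_mul, norm_mul]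
        refine (mul_le_of_le_one_right (norm_nonneg _) (mem_closedBall_zero_iff.1 z.2)).trans_lt ?_
        refine lt_of_eq_of_lt ?_ hN
        rw [← Complex.ofReal_sub, Complex.norm_real, ← sub_div, Nat.cast_succ, Real.norm_eq_abs,
          sub_add_cancel_left, abs_div, abs_neg, abs_one, abs_of_pos hN0]
  refine key (N + 1) le_rfl (fun z => z) (funext fun z => Subtype.ext ?_)
  have hN0 : ((N : ℝ) + 1) ≠ 0 := by positivity
  rw [Nat.cast_succ, div_self hN0, coe_discScale zero_le_one le_rfl]
  simp

end DiscFrame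

/-! ### Smoothness of the maps that define a glued atlas -/

section GluedSmooth

variable {𝕜 : Type*} [NontriviallyNormedField 𝕜] {E : Type*} [NormedAddCommGroup E]
  [NormedSpace 𝕜 E] {H : Type*} [TopologicalSpace H] {I : ModelWithCorners 𝕜 E H}
  {Y : Type*} [TopologicalSpace Y] [ChartedSpace H Y] {X : Type*} [TopologicalSpace X]

/-- In the charts c of Y and `a.trans c` of X, both a and its inverse become the identity. -/
theorem contMDiffOn_of_trans_mem_maximalAtlas [ChartedSpace H X] {n : ℕ∞ω} [IsManifold I n X]
    [IsManifold I n Y] (a : OpenPartialHomeomorph X Y)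
    (ha : ∀ c ∈ atlas H Y, a.trans c ∈ IsManifold.maximalAtlas I n X) :
    ContMDiffOn I I n a a.source ∧ ContMDiffOn I I n a.symm a.target := by
  constructor
  · intro x hx
    have hc := IsManifold.chart_mem_maximalAtlas (I := I) (n := n) (a x)
    have hac := ha _ (chart_mem_atlas H (a x))
    have hxs : x ∈ (a.trans (chartAt H (a x))).source := by simp [hx]
    refine ContMDiffAt.contMDiffWithinAt (ContMDiffOn.contMDiffAt (s := (a.trans (chartAt H (a
        x))).source) ?_
      ((a.trans (chartAt H (a x))).open_source.mem_nhds hxs))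
    rw [contMDiffOn_iff_of_mem_maximalAtlas hac hc subset_rfl
      (fun y hy => by simp only [mfld_simps] at hy; exact hy.2)]
    refine ⟨a.continuousOn.mono fun y hy => by simp only [mfld_simps] at hy; exact hy.1,
      contDiffOn_id.congr ?_⟩
    rintro _ ⟨y, hy, rfl⟩
    have := (a.trans (chartAt H (a x))).left_inv hy
    simp only [mfld_simps] at hy this ⊢
    rw [this]
  · intro y hy
    have hc := IsManifold.chart_mem_maximalAtlas (I := I) (n := n) y
    have hac := ha _ (chart_mem_atlas H y)
    have ho : IsOpen (a.target ∩ (chartAt H y).source) := a.open_target.inter (chartAt H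
        y).open_source
    refine ContMDiffAt.contMDiffWithinAt (ContMDiffOn.contMDiffAt
      (s := a.target ∩ (chartAt H y).source) ?_ (ho.mem_nhds ⟨hy, mem_chart_source H y⟩))
    have hmaps : MapsTo a.symm (a.target ∩ (chartAt H y).source) (a.trans (chartAt H y)).source :=
        by
      intro z hz
      simp only [mfld_simps] at hz ⊢
      exact ⟨a.map_target hz.1, (a.right_inv hz.1).symm ▸ hz.2⟩
    rw [contMDiffOn_iff_of_mem_maximalAtlas hc hac inter_subset_right hmaps]
    refine ⟨a.symm.continuousOn.mono fun z hz => hz.1, contDiffOn_id.congr ?_⟩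
    rintro _ ⟨z, hz, rfl⟩
    have := (chartAt H y).left_inv hz.2
    simp only [mfld_simps] at hz this ⊢
    rw [this, a.right_inv hz.1]

end GluedSmooth

/-! ### The vertical tangent space in a trivialization -/

section Smooth

open AssocBundle PuncturedPlane

theorem ProjLine.mdifferentiable_coord (i : Bool) :
    (ProjLine.coord i).MDifferentiable 𝓘(ℂ, ℂ) 𝓘(ℂ, ℂ) := by
  have h := contMDiffOn_of_trans_mem_maximalAtlas (I := 𝓘(ℂ, ℂ)) (n := ω) (ProjLine.coord i)
    fun c hc => IsManifold.subset_maximalAtlas ⟨ProjLine.coord i, by cases i <;> simp [atlas], c,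
        hc, rfl⟩
  exact ⟨h.1.mdifferentiableOn (by simp), h.2.mdifferentiableOn (by simp)⟩

variable {V : Type*} [NormedAddCommGroup V] [NormedSpace ℂ V]
  {M : Type*} [TopologicalSpace M] [ChartedSpace V M] [IsManifold 𝓘(ℂ, V) ω M]
  [MulAction ℂˣ M] [ContinuousSMul ℂˣ M] [ContMDiffSMul 𝓘(ℂ, ℂ) 𝓘(ℂ, V) ω ℂˣ M]

theorem AssocBundle.contMDiffOn_triv (i : Bool) :
    ContMDiffOn (𝓘(ℂ, V).prod 𝓘(ℂ, ℂ)) (𝓘(ℂ, V).prod 𝓘(ℂ, ℂ)) ω (triv M i) (triv M i).source ∧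
    ContMDiffOn (𝓘(ℂ, V).prod 𝓘(ℂ, ℂ)) (𝓘(ℂ, V).prod 𝓘(ℂ, ℂ)) ω (triv M i).symm
      (triv M i).target := by
  refine contMDiffOn_of_trans_mem_maximalAtlas (triv M i)
    fun c hc => IsManifold.subset_maximalAtlas ⟨triv M i, by cases i <;> simp [atlas], c, hc, rfl⟩

theorem AssocBundle.contMDiff_triv_symm (i : Bool) :
    ContMDiff (𝓘(ℂ, V).prod 𝓘(ℂ, ℂ)) (𝓘(ℂ, V).prod 𝓘(ℂ, ℂ)) ω (triv M i).symm :=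
  contMDiffOn_univ.1 (contMDiffOn_triv i).2

theorem AssocBundle.mdifferentiable_triv (i : Bool) :
    (triv M i).MDifferentiable (𝓘(ℂ, V).prod 𝓘(ℂ, ℂ)) (𝓘(ℂ, V).prod 𝓘(ℂ, ℂ)) :=
  ⟨(contMDiffOn_triv i).1.mdifferentiableOn (by simp),
    (contMDiffOn_triv i).2.mdifferentiableOn (by simp)⟩

/-- The derivative of the inclusion `x ↦ [x, (z, 1)]` (for `i = false`) or `x ↦ [x, (1, z)]` (for
`i = true`) of `M` as a fibre of the associated bundle. -/
def AssocBundle.fibreDeriv (i : Bool) (x : M) (z : ℂ) : V →ₗ[ℂ] V × ℂ :=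
  (mfderiv (𝓘(ℂ, V).prod 𝓘(ℂ, ℂ)) (𝓘(ℂ, V).prod 𝓘(ℂ, ℂ)) (triv M i).symm (x, z)).toLinearMap ∘ₗ
    LinearMap.inl ℂ V ℂ

theorem AssocBundle.injective_fibreDeriv (i : Bool) (x : M) (z : ℂ) :
    Function.Injective (fibreDeriv (V := V) i x z) := by
  have h := (mdifferentiable_triv (V := V) (M := M) i).symm.mfderiv_injective (x := (x, z))
      (mem_univ _)
  exact h.comp LinearMap.inl_injective

/-- In the trivialization the projection is (x, z) ↦ z followed by an affine parametrization of ℙ¹.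
Both parametrizations have bijective derivatives, so the kernel is the image of V × 0. -/
theorem AssocBundle.vertical_mk (i : Bool) (x : M) (z : ℂ) :
    vertical V (mk (x, aff i z)) = LinearMap.range (fibreDeriv (V := V) i x z) := by
  have hJ := (mdifferentiable_triv (V := V) (M := M) i).symm
  have hc := (ProjLine.mdifferentiable_coord i).symm
  have hsource : mk (x, aff i z) ∈ (triv M i).source := (triv M i).map_target (mem_univ (x, z))
  have hproj : MDifferentiableAt (𝓘(ℂ, V).prod 𝓘(ℂ, ℂ)) 𝓘(ℂ, ℂ) (proj : AssocBundle M → ProjLine)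
      (mk (x, aff i z)) := by
    have h1 : MDifferentiableAt (𝓘(ℂ, V).prod 𝓘(ℂ, ℂ)) 𝓘(ℂ, ℂ)
        (fun p : AssocBundle M => (ProjLine.coord i).symm (triv M i p).2) (mk (x, aff i z)) :=
      (hc.mdifferentiableAt (mem_univ _)).comp (mk (x, aff i z)) (mdifferentiableAt_snd.comp _
        ((mdifferentiable_triv (V := V) (M := M) i).mdifferentiableAt hsource))
    refine h1.congr_of_eventuallyEq ?_
    filter_upwards [(triv M i).open_source.mem_nhds hsource] with p hp
    conv_lhs => rw [← (triv M i).left_inv hp]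
    rfl
  have hJx := hJ.mdifferentiableAt (x := (x, z)) (mem_univ _)
  have hchain : ∀ v : V × ℂ, mfderiv (𝓘(ℂ, V).prod 𝓘(ℂ, ℂ)) 𝓘(ℂ, ℂ) proj (mk (x, aff i z))
      (mfderiv (𝓘(ℂ, V).prod 𝓘(ℂ, ℂ)) (𝓘(ℂ, V).prod 𝓘(ℂ, ℂ)) (triv M i).symm (x, z) v) =
      mfderiv 𝓘(ℂ, ℂ) 𝓘(ℂ, ℂ) (ProjLine.coord i).symm z v.2 := fun v => by
    have h1 := mfderiv_comp (x, z) hproj hJx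
    have h2 := mfderiv_comp (x, z) (hc.mdifferentiableAt (x := z) (mem_univ _))
      (mdifferentiableAt_snd (I := 𝓘(ℂ, V)) (I' := 𝓘(ℂ, ℂ)) (x := (x, z)))
    have h3 : (proj : AssocBundle M → ProjLine) ∘ (triv M i).symm =
      (ProjLine.coord i).symm ∘ Prod.snd := rfl
    rw [h3, h2] at h1
    have h4 := DFunLike.congr_fun h1 v
    rw [mfderiv_snd] at h4
    exact h4.symm
  ext v
  obtain ⟨v', rfl⟩ := hJ.mfderiv_surjective (x := (x, z)) (mem_univ _) v
  have hinj := hc.mfderiv_injective (x := z) (mem_univ _)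
  refine (show _ ↔ mfderiv (𝓘(ℂ, V).prod 𝓘(ℂ, ℂ)) 𝓘(ℂ, ℂ) proj (mk (x, aff i z))
      (mfderiv (𝓘(ℂ, V).prod 𝓘(ℂ, ℂ)) (𝓘(ℂ, V).prod 𝓘(ℂ, ℂ)) (triv M i).symm (x, z) v') = 0
      from Iff.rfl).trans ((iff_of_eq (congrArg (· = (0 : ℂ)) (hchain v'))).trans ?_)
  constructor
  · intro h
    have h0 : v'.2 = 0 := hinj (h.trans (map_zero _).symm)
    exact ⟨v'.1, congrArg (mfderiv (𝓘(ℂ, V).prod 𝓘(ℂ, ℂ)) (𝓘(ℂ, V).prod 𝓘(ℂ, ℂ)) (triv M i).symm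
        (x, z))
      (show ((v'.1, 0) : V × ℂ) = v' from Prod.ext rfl h0.symm)⟩
  · rintro ⟨w, hw⟩
    have := hJ.mfderiv_injective (x := (x, z)) (mem_univ _) hw
    have h0 : v'.2 = 0 := (congrArg Prod.snd this).symm
    exact (congrArg (mfderiv 𝓘(ℂ, ℂ) 𝓘(ℂ, ℂ) (ProjLine.coord i).symm z) h0).trans (map_zero _)

end Smooth

/-! ### Frames, and independence of the Chern number from them -/

section FrameLemmas

variable {E : Type*} [NormedAddCommGroup E] [NormedSpace ℂ E] [FiniteDimensional ℂ E]
  {H : Type*} [TopologicalSpace H]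
  {I : ModelWithCorners ℂ E H} {X : Type*} [TopologicalSpace X] [ChartedSpace H X]
  [IsManifold I 1 X] {W : ∀ x : X, Submodule ℂ (TangentSpace I x)} {n : ℕ}
  {Z : Type*} [TopologicalSpace Z]

theorem ComplexFrame.continuous_det {f : Z → X} (a b : ComplexFrame I W n f) :
    Continuous fun z => (a.basis z).det (b.basis z) :=
  continuous_det_section (F := E) (E := TangentSpace I) W a.basis a.continuous_basis
    (fun z => b.basis z) b.continuous_basis

theorem Module.Basis.det_basis_ne_zero {R N ι : Type*} [CommRing R] [Nontrivial R] [AddCommGroup N]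
    [Module R N] [Fintype ι] [DecidableEq ι] (a b : Module.Basis ι R N) : a.det b ≠ 0 := by
  intro h
  have := a.det_mul_det b a
  rw [h, zero_mul, Module.Basis.det_self] at this
  exact zero_ne_one this

/-- A continuous family of bases made of prescribed continuous sections is a frame. -/
theorem exists_complexFrame {f : Z → X} (v : ∀ z, Fin n → TangentSpace I (f z))
    (hW : ∀ z j, v z j ∈ W (f z)) (hn : ∀ z, Module.finrank ℂ (W (f z)) = n)
    (hv : ∀ z, LinearIndependent ℂ (v z))
    (hc : ∀ j, Continuous fun z => (⟨f z, v z j⟩ : TangentBundle I X)) :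
    ∃ a : ComplexFrame I W n f, ∀ z j, (a.basis z j : TangentSpace I (f z)) = v z j := by
  have hli : ∀ z, LinearIndependent ℂ fun j => (⟨v z j, hW z j⟩ : W (f z)) := fun z =>
    LinearIndependent.of_comp (W (f z)).subtype (hv z)
  have : ∀ z, FiniteDimensional ℂ (W (f z)) := fun z =>
    haveI : FiniteDimensional ℂ (TangentSpace I (f z)) := inferInstanceAs (FiniteDimensional ℂ E)
    inferInstance
  let b : ∀ z, Module.Basis (Fin n) ℂ (W (f z)) := fun z => Module.Basis.mk (hli z)
    ((hli z).span_eq_top_of_card_eq_finrank' (by simp [hn z])).ge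
  have hb : ∀ z j, (b z j : TangentSpace I (f z)) = v z j := fun z j => by simp [b]
  exact ⟨⟨b, fun j => by simpa only [hb] using hc j⟩, hb⟩

namespace ProjLine

theorem coord_mk_aff (i : Bool) (z : ℂ) : coord i (mk (PuncturedPlane.aff i z)) = z :=
  (coord i).right_inv (mem_univ z)

theorem continuous_mk_aff (i : Bool) : Continuous fun z => mk (PuncturedPlane.aff i z) :=
  isOpenQuotientMap_mk.continuous.comp (PuncturedPlane.continuous_aff i)

theorem ofCircle_eq (z : Circle) : ofCircle z = mk (PuncturedPlane.aff true (z⁻¹ : Circle)) := by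
  refine mk_eq_mk.2 ⟨Circle.toUnits z, PuncturedPlane.ext_aff false ?_ ?_⟩
  · change (z : ℂ) * 1 = z
    simp
  · change (z : ℂ) * (z⁻¹ : Circle) = 1
    simp

theorem exists_discCoord (i : Bool) {S : Set ProjLine}
    (hS : S = {p | ∃ z : ℂ, ‖z‖ ≤ 1 ∧ p = mk (PuncturedPlane.aff i z)}) :
    ∃ c : S → ClosedDisc, Continuous c ∧ ∀ p : S, (p : ProjLine) = mk (PuncturedPlane.aff i (c p))
        := by
  subst hS
  have hp : ∀ p : {p | ∃ z : ℂ, ‖z‖ ≤ 1 ∧ p = mk (PuncturedPlane.aff i z)},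
      ‖coord i p‖ ≤ 1 ∧ (p : ProjLine) = mk (PuncturedPlane.aff i (coord i p)) := by
    rintro ⟨_, z, hz, rfl⟩
    simp only [coord_mk_aff]
    exact ⟨hz, trivial⟩
  refine ⟨fun p => ⟨coord i p, mem_closedBall_zero_iff.2 (hp p).1⟩,
    Continuous.subtype_mk ?_ _, fun p => (hp p).2⟩
  refine (coord i).continuousOn.comp_continuous continuous_subtype_val fun p => ?_
  rw [(hp p).2]
  exact (coord i).map_target (mem_univ _)

end ProjLine

/-- The two transition determinants differ by the determinants of changes of frame over D₀ and D_∞.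
Each of these extends without zeros over its disc and has winding number 0. -/
theorem HasChernNumber.unique {f : ProjLine → X} {k l : ℤ} (hk : HasChernNumber I W n f k)
    (hl : HasChernNumber I W n f l) : k = l := by
  obtain ⟨a, b, hab⟩ := hk
  obtain ⟨a', b', hab'⟩ := hl
  have h1 : HasWindingNumber (fun z =>
      (a.basis ⟨ProjLine.ofCircle z, ProjLine.ofCircle_mem_discZero z⟩).det
        (a'.basis ⟨ProjLine.ofCircle z, ProjLine.ofCircle_mem_discZero z⟩)) 0 :=
    hasWindingNumber_zero_of_disc
      (g := fun z => (a.basis ⟨ProjLine.mk (PuncturedPlane.aff false z),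
        z, mem_closedBall_zero_iff.1 z.2, rfl⟩).det (a'.basis _))
      ((a.continuous_det a').comp (Continuous.subtype_mk
        ((ProjLine.continuous_mk_aff false).comp continuous_subtype_val) _))
      fun z => Module.Basis.det_basis_ne_zero _ _
  have h2 : HasWindingNumber (fun z =>
      (b'.basis ⟨ProjLine.ofCircle z, ProjLine.ofCircle_mem_discInfty z⟩).det
        (b.basis ⟨ProjLine.ofCircle z, ProjLine.ofCircle_mem_discInfty z⟩)) 0 := by
    -- The coordinate on D_∞ is w = z⁻¹, so its boundary runs backwards; this is harmless since -0 =
    -- 0.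
    have h3 := (hasWindingNumber_zero_of_disc
      (g := fun z => (b'.basis ⟨ProjLine.mk (PuncturedPlane.aff true z),
        z, mem_closedBall_zero_iff.1 z.2, rfl⟩).det (b.basis _))
      ((b'.continuous_det b).comp (Continuous.subtype_mk
        ((ProjLine.continuous_mk_aff true).comp continuous_subtype_val) _))
      fun z => Module.Basis.det_basis_ne_zero _ _).comp_inv
    rw [neg_zero] at h3
    convert h3 using 3 with z
    have hp : (⟨ProjLine.ofCircle z, ProjLine.ofCircle_mem_discInfty z⟩ : ProjLine.discInfty) =
      ⟨ProjLine.mk (PuncturedPlane.aff true (bdry z⁻¹)), _, mem_closedBall_zero_iff.1 (bdry z⁻¹).2,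
          rfl⟩ :=
      Subtype.ext (ProjLine.ofCircle_eq z)
    rw [hp]
  have h3 := (h1.mul hab').mul h2
  simp only [Module.Basis.det_mul_det, zero_add, add_zero] at h3
  exact hab.unique h3

theorem hasChernNumber_iff_of_exists {f : ProjLine → X} (h : ∃ k, HasChernNumber I W n f k) (k : ℤ)
    :
    HasChernNumber I W n f k ↔ k = chernNumber I W n f := by
  have hc : HasChernNumber I W n f (chernNumber I W n f) := by
    rw [chernNumber, dif_pos h]
    exact h.choose_spec
  exact ⟨fun hk => hk.unique hc, fun hk => hk ▸ hc⟩

end FrameLemmas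

/-- An injective linear map which sends two families in a space with basis to two bases preserves
the determinant. -/
theorem det_eq_det_of_map {V₁ V₂ : Type*} [AddCommGroup V₁] [Module ℂ V₁] [AddCommGroup V₂]
    [Module ℂ V₂] {n : ℕ} {W₁ : Submodule ℂ V₁} {W₂ : Submodule ℂ V₂} (T : V₁ →ₗ[ℂ] V₂)
    (e : Module.Basis (Fin n) ℂ W₁) (b : Module.Basis (Fin n) ℂ W₂) (c : Fin n → W₁) (a : Fin n →
        W₂)
    (hb : ∀ j, (b j : V₂) = T (e j)) (ha : ∀ j, (a j : V₂) = T (c j)) :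
    b.det a = e.det c := by
  rw [Module.Basis.det_apply, Module.Basis.det_apply]
  congr 1
  ext i j
  have h : a j = ∑ k, e.toMatrix c k j • b k := by
    refine Subtype.ext ?_
    have h1 := congrArg W₁.subtype (e.sum_toMatrix_smul_self c j).symm
    rw [map_sum] at h1
    rw [ha, show (c j : V₁) = _ from h1]
    simp [hb]
  rw [Module.Basis.toMatrix_apply, h, map_sum]
  simp [Finsupp.single_apply]

/-! ### Frames of the tangent bundle along a disc -/

section DiscFrames

variable {V : Type*} [NormedAddCommGroup V] [NormedSpace ℂ V]
  {M : Type*} [TopologicalSpace M] [ChartedSpace V M] [IsManifold 𝓘(ℂ, V) ω M]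

/-- The tangent bundle of a complex manifold is trivial along a disc. -/
theorem exists_complexFrame_disc [FiniteDimensional ℂ V] (u : C(ClosedDisc, M)) :
    Nonempty (ComplexFrame 𝓘(ℂ, V) (fun _ : M => ⊤) (Module.finrank ℂ V) u) := by
  let _ : ∀ z, AddCommGroup ((u *ᵖ (TangentSpace 𝓘(ℂ, V) : M → Type _)) z) := fun z =>
    inferInstanceAs (AddCommGroup (TangentSpace 𝓘(ℂ, V) (u z)))
  obtain ⟨s, hs, hli⟩ := exists_continuous_frame_disc V (u *ᵖ (TangentSpace 𝓘(ℂ, V) : M → Type _))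
  refine ⟨(exists_complexFrame (W := fun _ : M => ⊤) (fun z j => s j z) (fun _ _ => trivial) (fun z
      => ?_) hli
    fun j => ?_).choose⟩
  · rw [finrank_top]
    rfl
  · exact (_root_.Pullback.continuous_lift V (TangentSpace 𝓘(ℂ, V) : M → Type _) u).comp (hs j)

end DiscFrames

/-! ### Derivatives of the action -/

section Action

variable {V : Type*} [NormedAddCommGroup V] [NormedSpace ℂ V]
  {M : Type*} [TopologicalSpace M] [ChartedSpace V M]
  [MulAction ℂˣ M] [ContMDiffSMul 𝓘(ℂ, ℂ) 𝓘(ℂ, V) ω ℂˣ M]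

theorem mdifferentiableAt_units_smul (c : ℂˣ) (x : M) :
    MDifferentiableAt 𝓘(ℂ, V) 𝓘(ℂ, V) (fun y : M => c • y) x :=
  (ContMDiffSMul.contMDiff_const_smul (I := 𝓘(ℂ, ℂ)) (n := ω) c).mdifferentiable (by simp) x

theorem injective_mfderiv_units_smul (c : ℂˣ) (x : M) :
    Function.Injective (mfderiv 𝓘(ℂ, V) 𝓘(ℂ, V) (fun y : M => c • y) x) := by
  have h := mfderiv_comp x (mdifferentiableAt_units_smul (V := V) c⁻¹ (c • x))
    (mdifferentiableAt_units_smul c x)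
  have h1 : (fun y : M => c⁻¹ • y) ∘ (fun y : M => c • y) = id := funext (inv_smul_smul c)
  rw [h1, mfderiv_id] at h
  refine Function.Injective.of_comp
    (f := mfderiv 𝓘(ℂ, V) 𝓘(ℂ, V) (fun y : M => c⁻¹ • y) (c • x)) fun v w hvw => ?_
  exact (DFunLike.congr_fun h v).trans (hvw.trans (DFunLike.congr_fun h w).symm)

end Action

/-! ### The vertical Chern number as a winding number -/

section DiscSectionFrames

open AssocBundle PuncturedPlane

variable {V : Type*} [NormedAddCommGroup V] [NormedSpace ℂ V]
  {M : Type*} [TopologicalSpace M] [ChartedSpace V M] [IsManifold 𝓘(ℂ, V) ω M]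
  [MulAction ℂˣ M] [ContinuousSMul ℂˣ M] [ContMDiffSMul 𝓘(ℂ, ℂ) 𝓘(ℂ, V) ω ℂˣ M]

/-- The vector is the image of (v, 0), tangent to M × ℂ, under the continuous tangent map of the
inverse trivialization. -/
theorem AssocBundle.continuous_fibreDeriv {Z : Type*} [TopologicalSpace Z] (i : Bool) {x : Z → M}
    {v : ∀ z, TangentSpace 𝓘(ℂ, V) (x z)}
    (hv : Continuous fun z => (⟨x z, v z⟩ : TangentBundle 𝓘(ℂ, V) M)) {c : Z → ℂ} (hc : Continuous
        c) :
    Continuous fun z => (⟨mk (x z, aff i (c z)), fibreDeriv i (x z) (c z) (v z)⟩ :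
      TangentBundle (𝓘(ℂ, V).prod 𝓘(ℂ, ℂ)) (AssocBundle M)) := by
  have h1 : Continuous fun z => (⟨c z, 0⟩ : TangentBundle 𝓘(ℂ, ℂ) ℂ) :=
    (Bundle.Trivialization.continuous_zeroSection ℂ (F := ℂ) (E := TangentSpace 𝓘(ℂ, ℂ))).comp hc
  have h2 := (contMDiff_equivTangentBundleProd_symm (n := 0) (I := 𝓘(ℂ, V)) (M := M)
    (I' := 𝓘(ℂ, ℂ)) (M' := ℂ)).continuous.comp (hv.prodMk h1)
  have h3 := ((contMDiff_triv_symm (V := V) (M := M) i).continuous_tangentMap (by simp)).comp h2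
  exact h3

/-- Expressing the fibre derivative through a map of M alone makes the chain rule applicable to the
comparison of the two trivializations. -/
theorem AssocBundle.fibreDeriv_eq_mfderiv (i : Bool) (x : M) (z : ℂ) (v : V) :
    fibreDeriv i x z v =
      mfderiv 𝓘(ℂ, V) (𝓘(ℂ, V).prod 𝓘(ℂ, ℂ)) (fun y : M => mk (y, aff i z)) x v := by
  have h1 := mfderiv_comp x (((contMDiff_triv_symm (V := V) (M := M) i).mdifferentiable (by simp))
      (x, z))
    (show MDifferentiableAt 𝓘(ℂ, V) (𝓘(ℂ, V).prod 𝓘(ℂ, ℂ)) (fun y : M => (y, z)) x from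
      mdifferentiableAt_id.prodMk mdifferentiableAt_const)
  rw [mfderiv_prod_left] at h1
  exact (DFunLike.congr_fun h1 v).symm

/-- The identification of the fibre over `[z : 1] = [1 : z⁻¹]` in the two trivializations is the
action of `z⁻¹`. -/
theorem AssocBundle.fibreDeriv_false (x : M) (z : ℂˣ) (v : V) :
    fibreDeriv false x z v = fibreDeriv (V := V) true (z⁻¹ • x) (z⁻¹ : ℂˣ)
      (mfderiv 𝓘(ℂ, V) 𝓘(ℂ, V) (fun y : M => z⁻¹ • y) x v) := by
  have h : (fun y : M => mk (y, aff false z)) =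
      (fun y : M => mk (y, aff true (z⁻¹ : ℂˣ))) ∘ fun y : M => z⁻¹ • y := by
    funext y
    refine mk_eq_mk.2 ⟨z, Prod.ext (smul_inv_smul z y) (ext_aff false ?_ ?_)⟩
    · change (z : ℂ) * 1 = z
      simp
    · change (z : ℂ) * (z⁻¹ : ℂˣ) = 1
      simp
  have hd : MDifferentiableAt 𝓘(ℂ, V) (𝓘(ℂ, V).prod 𝓘(ℂ, ℂ))
      (fun y : M => mk (y, aff true (z⁻¹ : ℂˣ))) (z⁻¹ • x) :=
    (((contMDiff_triv_symm (V := V) (M := M) true).mdifferentiable (by simp)) _).comp (z⁻¹ • x)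
      (show MDifferentiableAt 𝓘(ℂ, V) (𝓘(ℂ, V).prod 𝓘(ℂ, ℂ))
        (fun y : M => (y, ((z⁻¹ : ℂˣ) : ℂ))) (z⁻¹ • x) from
        mdifferentiableAt_id.prodMk mdifferentiableAt_const)
  refine (fibreDeriv_eq_mfderiv false x z v).trans (Eq.trans ?_
    (fibreDeriv_eq_mfderiv true (z⁻¹ • x) (z⁻¹ : ℂˣ) _).symm)
  rw [h, mfderiv_comp x hd (mdifferentiableAt_units_smul z⁻¹ x)]
  rfl

theorem AssocBundle.finrank_vertical [FiniteDimensional ℂ V] (p : AssocBundle M) :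
    Module.finrank ℂ (vertical V p) = Module.finrank ℂ V := by
  obtain ⟨i, x, z, rfl⟩ : ∃ i x z, p = mk (x, aff i z) := by
    rcases mem_triv_source p with h | h
    · exact ⟨_, _, _, ((triv M _).left_inv h).symm⟩
    · exact ⟨_, _, _, ((triv M _).left_inv h).symm⟩
  rw [vertical_mk]
  exact LinearMap.finrank_range_of_inj (f := fibreDeriv (V := V) i x z) (injective_fibreDeriv i x z)

/-- For a basis `b` of the tangent space at `u 1`, the vertical Chern number of `σ(u)` is the
winding number of the determinant of the translates of `b` in a complex frame on the disc. -/
theorem exists_hasChernNumber_discSection [FiniteDimensional ℂ V] (u : C(ClosedDisc, M))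
    (hu : ∀ z : Circle, u (bdry z) = Circle.toUnits z • u (bdry 1))
    (e : ComplexFrame 𝓘(ℂ, V) (fun _ : M => ⊤) (Module.finrank ℂ V) u)
    (b : Module.Basis (Fin (Module.finrank ℂ V)) ℂ V) :
    ∃ k, HasChernNumber (𝓘(ℂ, V).prod 𝓘(ℂ, ℂ)) (AssocBundle.vertical V)
        (Module.finrank ℂ V) (AssocBundle.discSection u) k ∧
      HasWindingNumber (fun z => (e.basis (bdry z)).det fun j =>
        ⟨mfderiv 𝓘(ℂ, V) 𝓘(ℂ, V) (fun y : M => Circle.toUnits z • y) (u (bdry 1)) (b j), trivial⟩)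
            k := by
  obtain ⟨c₀, hc₀, hp₀⟩ := ProjLine.exists_discCoord false (S := ProjLine.discZero) rfl
  obtain ⟨c₁, hc₁, hp₁⟩ := ProjLine.exists_discCoord true (S := ProjLine.discInfty) rfl
  have hσ₀ : ∀ p : ProjLine.discZero, discSection u p = mk (u (bdry 1), aff false (c₀ p)) := fun p
      => by
    conv_lhs => rw [hp₀ p]
    exact discSection_zero u (mem_closedBall_zero_iff.1 (c₀ p).2)
  have hσ₁ : ∀ p : ProjLine.discInfty, discSection u p = mk (u (c₁ p), aff true (c₁ p)) := fun p =>
      by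
    conv_lhs => rw [hp₁ p]
    exact discSection_infty u hu (c₁ p)
  -- The frame over D₀ comes from the fixed basis b, because the M-component of the section is
  -- constantly u(1) there.
  obtain ⟨a, ha⟩ := exists_complexFrame (I := 𝓘(ℂ, V).prod 𝓘(ℂ, ℂ)) (W := AssocBundle.vertical V)
    (f := fun p : ProjLine.discZero => discSection u p)
    (fun p j => fibreDeriv (V := V) false (u (bdry 1)) (c₀ p) (b j))
    (fun p j => by
      rw [hσ₀ p, vertical_mk]
      exact ⟨b j, rfl⟩)
    (fun p => finrank_vertical _)
    (fun p => b.linearIndependent.map' _ (LinearMap.ker_eq_bot.2 (injective_fibreDeriv _ _ _)))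
    (fun j => by
      have := continuous_fibreDeriv (V := V) false (x := fun _ => u (bdry 1)) (v := fun _ => b j)
        continuous_const (continuous_subtype_val.comp hc₀)
      convert this using 1
      funext p
      -- All tangent spaces are the model space V × ℂ, so only the base point has to be rewritten.
      exact congrArg (fun q => (⟨q, fibreDeriv (V := V) false (u (bdry 1)) (c₀ p) (b j)⟩ :
        TangentBundle (𝓘(ℂ, V).prod 𝓘(ℂ, ℂ)) (AssocBundle M))) (hσ₀ p))
  let v : ClosedDisc → Fin (Module.finrank ℂ V) → V := fun w j =>
    (e.basis w j : TangentSpace 𝓘(ℂ, V) (u w))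
  have hv : ∀ w, LinearIndependent ℂ (v w) := fun w =>
    (e.basis w).linearIndependent.map' (Submodule.subtype _) (Submodule.ker_subtype _)
  -- The frame over D_∞ comes from e, because the M-component of the section is u(w) there.
  obtain ⟨a', ha'⟩ := exists_complexFrame (I := 𝓘(ℂ, V).prod 𝓘(ℂ, ℂ)) (W := AssocBundle.vertical V)
    (f := fun p : ProjLine.discInfty => discSection u p)
    (fun p j => fibreDeriv (V := V) true (u (c₁ p)) (c₁ p) (v (c₁ p) j))
    (fun p j => by
      rw [hσ₁ p, vertical_mk]
      exact ⟨_, rfl⟩)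
    (fun p => finrank_vertical _)
    (fun p => (hv _).map' _ (LinearMap.ker_eq_bot.2 (injective_fibreDeriv _ _ _)))
    (fun j => by
      have := continuous_fibreDeriv (V := V) true ((e.continuous_basis j).comp hc₁)
        (continuous_subtype_val.comp hc₁)
      convert this using 1
      funext p
      exact congrArg (fun q => (⟨q, fibreDeriv (V := V) true (u (c₁ p)) (c₁ p) (v (c₁ p) j)⟩ :
        TangentBundle (𝓘(ℂ, V).prod 𝓘(ℂ, ℂ)) (AssocBundle M))) (hσ₁ p))
  have hcircle : Continuous ProjLine.ofCircle :=
    (ProjLine.continuous_mk_aff false).comp continuous_subtype_val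
  obtain ⟨k, hk⟩ := exists_hasWindingNumber (f := fun z =>
      (a.basis ⟨ProjLine.ofCircle z, ProjLine.ofCircle_mem_discZero z⟩).det
        (a'.basis ⟨ProjLine.ofCircle z, ProjLine.ofCircle_mem_discInfty z⟩))
    (continuous_det_section (F := V × ℂ) (E := TangentSpace (𝓘(ℂ, V).prod 𝓘(ℂ, ℂ)))
      (f := fun z => discSection u (ProjLine.ofCircle z)) (vertical V)
      (fun z => a.basis ⟨ProjLine.ofCircle z, ProjLine.ofCircle_mem_discZero z⟩)
      (fun j => (a.continuous_basis j).comp (hcircle.subtype_mk _))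
      (fun z => a'.basis ⟨ProjLine.ofCircle z, ProjLine.ofCircle_mem_discInfty z⟩)
      (fun j => (a'.continuous_basis j).comp (hcircle.subtype_mk _)))
    (fun z => Module.Basis.det_basis_ne_zero _ _)
  refine ⟨k, ⟨a, a', hk⟩, ?_⟩
  have hc₀z : ∀ z : Circle, (c₀ ⟨ProjLine.ofCircle z, ProjLine.ofCircle_mem_discZero z⟩ : ℂ) = z :=
    fun z => by
      have := congrArg (ProjLine.coord false)
        (hp₀ ⟨ProjLine.ofCircle z, ProjLine.ofCircle_mem_discZero z⟩)
      rw [ProjLine.coord_mk_aff] at this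
      exact this.symm.trans (ProjLine.coord_mk_aff false z)
  have hc₁z : ∀ z : Circle,
      c₁ ⟨ProjLine.ofCircle z, ProjLine.ofCircle_mem_discInfty z⟩ = bdry z⁻¹ := fun z => by
    have := congrArg (ProjLine.coord true)
      (hp₁ ⟨ProjLine.ofCircle z, ProjLine.ofCircle_mem_discInfty z⟩)
    rw [ProjLine.coord_mk_aff] at this
    refine Subtype.ext (this.symm.trans ?_)
    change ProjLine.coord true (ProjLine.ofCircle z) = _
    rw [ProjLine.ofCircle_eq, ProjLine.coord_mk_aff]
    rfl
  -- The fibre inclusion of the second trivialization carries e to the frame on D_∞ and, by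
  -- `fibreDeriv_false`, the translates of b by z⁻¹ to the frame on D₀.
  have hdet : ∀ z : Circle,
      (a'.basis ⟨ProjLine.ofCircle z, ProjLine.ofCircle_mem_discInfty z⟩).det
        (a.basis ⟨ProjLine.ofCircle z, ProjLine.ofCircle_mem_discZero z⟩) =
      (e.basis (bdry z⁻¹)).det fun j => ⟨mfderiv 𝓘(ℂ, V) 𝓘(ℂ, V)
        (fun y : M => Circle.toUnits z⁻¹ • y) (u (bdry 1)) (b j), trivial⟩ := fun z => by
    refine det_eq_det_of_map (V₁ := V) (V₂ := V × ℂ)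
      (fibreDeriv (V := V) true (u (bdry z⁻¹)) (bdry z⁻¹)) (e.basis (bdry z⁻¹)) _ _ _
      (fun j => ?_) (fun j => ?_)
    · refine (ha' _ j).trans ?_
      rw [hc₁z z]
      rfl
    · refine (ha _ j).trans ?_
      rw [hc₀z z]
      refine (fibreDeriv_false (u (bdry 1)) (Circle.toUnits z) (b j)).trans ?_
      rw [hu z⁻¹, map_inv]
      rfl
  -- One sign comes from inverting the transition determinant, the other from z ↦ z⁻¹; they cancel.
  have h := hk.inv.comp_inv
  rw [neg_neg] at h
  convert h using 2 with z
  have h1 := hdet z⁻¹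
  rw [inv_inv] at h1
  rw [← h1]
  exact eq_inv_of_mul_eq_one_right (by rw [Module.Basis.det_mul_det, Module.Basis.det_self])

end DiscSectionFrames

/-! ### Continuity of the section -/

section DiscSectionContinuous

open PuncturedPlane

/-- This homogeneous description shows that the two discs are closed and that they cover the
projective line. -/
theorem ProjLine.mk_mem_disc_iff (i : Bool) (v : PuncturedPlane) :
    mk v ∈ {p | ∃ z : ℂ, ‖z‖ ≤ 1 ∧ p = mk (aff i z)} ↔ ‖v.num i‖ ≤ ‖v.den i‖ := by
  constructor
  · rintro ⟨z, hz, h⟩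
    obtain ⟨c, rfl⟩ := mk_eq_mk.1 h
    simpa using mul_le_of_le_one_right (norm_nonneg (c : ℂ)) hz
  · intro h
    have h0 : v.den i ≠ 0 := fun h0 => by
      have h1 : v.num i = 0 := by simpa [h0] using h
      exact v.2 (by cases i <;> [exact Prod.ext h1 h0; exact Prod.ext h0 h1])
    refine ⟨v.num i / v.den i, ?_, mk_eq_mk.2 ⟨toUnit (v.den i), ext_aff i ?_ ?_⟩⟩
    · rw [norm_div]
      exact div_le_one_of_le₀ h (norm_nonneg _)
    · simp [coe_toUnit h0, mul_div_cancel₀ _ h0]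
    · simp [coe_toUnit h0]

theorem ProjLine.isClosed_disc (i : Bool) :
    IsClosed {p | ∃ z : ℂ, ‖z‖ ≤ 1 ∧ p = ProjLine.mk (aff i z)} := by
  rw [← isOpenQuotientMap_mk.isQuotientMap.isClosed_preimage]
  convert isClosed_le (continuous_num i).norm (continuous_den i).norm using 1
  exact Set.ext (mk_mem_disc_iff i)

namespace AssocBundle

variable {M : Type*} [TopologicalSpace M] [MulAction ℂˣ M]

theorem proj_discSection (u : C(ClosedDisc, M)) (p : ProjLine) : proj (discSection u p) = p := by
  obtain ⟨v, rfl⟩ := ProjLine.isOpenQuotientMap_mk.surjective p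
  change proj (discSectionAux u v) = _
  unfold discSectionAux
  split_ifs <;> rfl

/-- The section is continuous on each of two closed discs covering the line; the boundary condition
on u makes the formula over D_∞ valid on the common circle too. -/
theorem continuous_discSection [ContinuousSMul ℂˣ M] (u : C(ClosedDisc, M))
    (hu : ∀ z : Circle, u (bdry z) = Circle.toUnits z • u (bdry 1)) :
    Continuous (discSection u) := by
  obtain ⟨c₀, hc₀, hp₀⟩ := ProjLine.exists_discCoord false (S := ProjLine.discZero) rfl
  obtain ⟨c₁, hc₁, hp₁⟩ := ProjLine.exists_discCoord true (S := ProjLine.discInfty) rfl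
  have h₀ : ContinuousOn (discSection u) ProjLine.discZero := by
    rw [continuousOn_iff_continuous_domRestrict]
    have : Continuous fun p => mk (u (bdry 1), aff false (c₀ p)) :=
      isOpenQuotientMap_mk.continuous.comp (continuous_const.prodMk
        ((continuous_aff false).comp (continuous_subtype_val.comp hc₀)))
    refine this.congr fun p => ?_
    conv_rhs => rw [Set.domRestrict_apply, hp₀ p]
    exact (discSection_zero u (mem_closedBall_zero_iff.1 (c₀ p).2)).symm
  have h₁ : ContinuousOn (discSection u) ProjLine.discInfty := by
    rw [continuousOn_iff_continuous_domRestrict]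
    have : Continuous fun p => mk (u (c₁ p), aff true (c₁ p)) :=
      isOpenQuotientMap_mk.continuous.comp ((u.continuous.comp hc₁).prodMk
        ((continuous_aff true).comp (continuous_subtype_val.comp hc₁)))
    refine this.congr fun p => ?_
    conv_rhs => rw [Set.domRestrict_apply, hp₁ p]
    exact (discSection_infty u hu (c₁ p)).symm
  have hcover : ProjLine.discZero ∪ ProjLine.discInfty = univ := by
    refine eq_univ_of_forall fun p => ?_
    obtain ⟨v, rfl⟩ := ProjLine.isOpenQuotientMap_mk.surjective p
    exact (le_total ‖v.fst‖ ‖v.snd‖).imp (ProjLine.mk_mem_disc_iff false v).2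
      (ProjLine.mk_mem_disc_iff true v).2
  rw [← continuousOn_univ, ← hcover]
  exact h₀.union_of_isClosed h₁ (ProjLine.isClosed_disc false) (ProjLine.isClosed_disc true)

end AssocBundle

end DiscSectionContinuous

/-! ### Totally real subspaces and determinants -/

section RealLinearAlgebra

variable {V : Type*} [AddCommGroup V] [Module ℂ V] {n : ℕ}

/-- In a totally real subspace, real linear independence implies complex linear independence. -/
theorem linearIndependent_complex_of_totallyReal {T : Submodule ℝ V}
    (hT : ∀ v ∈ T, Complex.I • v ∈ T → v = 0) {b : Fin n → V} (hb : LinearIndependent ℝ b)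
    (hbT : ∀ j, b j ∈ T) : LinearIndependent ℂ b := by
  refine Fintype.linearIndependent_iff.2 fun c hc j => ?_
  have hsum : ∀ r : Fin n → ℝ, ∑ j, r j • b j ∈ T := fun r =>
    T.sum_mem fun j _ => T.smul_mem _ (hbT j)
  have hsplit : ∑ j, (c j).re • b j + Complex.I • ∑ j, (c j).im • b j = 0 := by
    rw [← hc, Finset.smul_sum, ← Finset.sum_add_distrib]
    refine Finset.sum_congr rfl fun j _ => ?_
    conv_rhs => rw [← Complex.re_add_im (c j)]
    rw [add_smul, mul_comm, mul_smul]
    rfl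
  have him : ∑ j, (c j).im • b j = 0 := by
    -- If x + iy = 0 with x and y in T, then iy = -x also lies in T, and total reality gives y = 0.
    refine hT _ (hsum _) ?_
    rw [(neg_eq_of_add_eq_zero_right hsplit).symm]
    exact T.neg_mem (hsum _)
  rw [him, smul_zero, add_zero] at hsplit
  exact Complex.ext (Fintype.linearIndependent_iff.1 hb _ hsplit j)
    (Fintype.linearIndependent_iff.1 hb _ him j)

/-- The determinants of two real bases of a real subspace differ by a real factor. -/
theorem exists_real_det_eq {T : Submodule ℝ V} (hT : Module.finrank ℝ T = n) {b b' : Fin n → V}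
    (hb : LinearIndependent ℝ b) (hbT : ∀ j, b j ∈ T) (hbT' : ∀ j, b' j ∈ T)
    (e : Module.Basis (Fin n) ℂ (⊤ : Submodule ℂ V)) :
    ∃ r : ℝ, (e.det fun j => ⟨b' j, trivial⟩) = r * e.det fun j => ⟨b j, trivial⟩ := by
  have hspan : ∀ j, b' j ∈ Submodule.span ℝ (range b) := fun j => by
    have hfin : FiniteDimensional ℝ T := by
      -- A rank of 0 does not by itself give finite dimension, so in that case it is taken from the
      -- basis e.
      rcases Nat.eq_zero_or_pos n with h | h
      · have : FiniteDimensional ℂ V := Module.Finite.of_surjective (⊤ : Submodule ℂ V).subtype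
          (fun v => ⟨⟨v, trivial⟩, rfl⟩) (hM := Module.Finite.of_basis e)
        have : FiniteDimensional ℝ V := FiniteDimensional.complexToReal V
        infer_instance
      · exact Module.finite_of_finrank_pos (hT.symm ▸ h)
    have h1 : Submodule.span ℝ (range b) = T := by
      refine Submodule.eq_of_le_of_finrank_eq (Submodule.span_le.2 ?_) ?_
      · rintro _ ⟨j, rfl⟩
        exact hbT j
      · rw [finrank_span_eq_card hb, Fintype.card_fin, hT]
    rw [h1]
    exact hbT' j
  choose A hA using fun j => (Submodule.mem_span_range_iff_exists_fun ℝ).1 (hspan j)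
  let B : Matrix (Fin n) (Fin n) ℝ := Matrix.of fun k j => A j k
  refine ⟨B.det, ?_⟩
  have h : e.toMatrix (fun j => (⟨b' j, trivial⟩ : (⊤ : Submodule ℂ V))) =
      e.toMatrix (fun j => (⟨b j, trivial⟩ : (⊤ : Submodule ℂ V))) *
        Complex.ofRealHom.mapMatrix B := by
    ext i j
    have h1 : (⟨b' j, trivial⟩ : (⊤ : Submodule ℂ V)) = ∑ k, (A j k : ℂ) • ⟨b k, trivial⟩ := by
      refine Subtype.ext ?_
      change b' j = (⊤ : Submodule ℂ V).subtype _
      rw [map_sum, ← hA j]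
      rfl
    rw [Module.Basis.toMatrix_apply, h1, map_sum, Matrix.mul_apply]
    simp [Module.Basis.toMatrix_apply, B, mul_comm, -Complex.coe_smul]
  rw [Module.Basis.det_apply, h, Matrix.det_mul, ← RingHom.map_det, Module.Basis.det_apply,
      mul_comm]
  rfl

/-- A nonzero real factor contributes r² / |r|² = 1; this is why the Maslov index uses the square of
the determinant. -/
theorem sq_div_norm_sq_real_mul {r : ℝ} {d : ℂ} (h : (r * d : ℂ) ≠ 0) :
    (r * d) ^ 2 / (‖r * d‖ : ℂ) ^ 2 = d ^ 2 / (‖d‖ : ℂ) ^ 2 := by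
  have hr : (r : ℂ) ≠ 0 := left_ne_zero_of_mul h
  have h1 : ((|r| : ℝ) : ℂ) ^ 2 = (r : ℂ) ^ 2 := by
    rw [← Complex.ofReal_pow, sq_abs, Complex.ofReal_pow]
  rw [norm_mul, Complex.norm_real, Real.norm_eq_abs, Complex.ofReal_mul, mul_pow, mul_pow, h1]
  exact mul_div_mul_left _ _ (pow_ne_zero 2 hr)

theorem det_ne_zero_of_linearIndependent [FiniteDimensional ℂ V]
    (e : Module.Basis (Fin n) ℂ (⊤ : Submodule ℂ V)) {b : Fin n → V} (hb : LinearIndependent ℂ b) :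
    (e.det fun j => ⟨b j, trivial⟩) ≠ 0 := by
  have hli : LinearIndependent ℂ fun j => (⟨b j, trivial⟩ : (⊤ : Submodule ℂ V)) :=
    LinearIndependent.of_comp (⊤ : Submodule ℂ V).subtype hb
  have hn : Module.finrank ℂ (⊤ : Submodule ℂ V) = n := by
    rw [Module.finrank_eq_card_basis e, Fintype.card_fin]
  exact ((Module.Basis.is_basis_iff_det e).1 ⟨hli,
    hli.span_eq_top_of_card_eq_finrank' (by simp [hn])⟩).ne_zero

end RealLinearAlgebra

/-! ### From complex to real derivatives -/

section RestrictScalars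

variable {V : Type*} [NormedAddCommGroup V] [NormedSpace ℂ V]
  {M : Type*} [TopologicalSpace M] [ChartedSpace V M]

theorem isManifold_real_of_complex {n : ℕ∞ω} [IsManifold 𝓘(ℂ, V) n M] : IsManifold 𝓘(ℝ, V) n M :=
  isManifold_of_contDiffOn _ _ _ fun _ _ he he' =>
    ContDiffOn.restrict_scalars ℝ (𝕜' := ℂ)
      (mem_groupoid_of_pregroupoid.1 (HasGroupoid.compatible (G := contDiffGroupoid n 𝓘(ℂ, V)) he
          he')).1

theorem ContMDiff.restrictScalars_real {n : ℕ∞ω} {f : M → M} (hf : ContMDiff 𝓘(ℂ, V) 𝓘(ℂ, V) n f) :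
    ContMDiff 𝓘(ℝ, V) 𝓘(ℝ, V) n f := fun x => by
  have := contMDiffAt_iff.1 (hf x)
  exact contMDiffAt_iff.2 ⟨this.1, this.2.restrict_scalars ℝ⟩

theorem mfderiv_real_eq {f : M → M} {x : M} (hf : MDifferentiableAt 𝓘(ℂ, V) 𝓘(ℂ, V) f x) (v : V) :
    mfderiv 𝓘(ℝ, V) 𝓘(ℝ, V) f x v = mfderiv 𝓘(ℂ, V) 𝓘(ℂ, V) f x v := by
  have hc := (mdifferentiableAt_iff _ _).1 hf
  have hd : DifferentiableAt ℂ (writtenInExtChartAt 𝓘(ℂ, V) 𝓘(ℂ, V) x f)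
      (extChartAt 𝓘(ℂ, V) x x) := by
    exact differentiableWithinAt_univ.1 (by simpa only [modelWithCornersSelf_coe, range_id] using
        hc.2)
  have hr : MDifferentiableAt 𝓘(ℝ, V) 𝓘(ℝ, V) f x :=
    (mdifferentiableAt_iff _ _).2 ⟨hc.1, (hd.restrictScalars ℝ).differentiableWithinAt⟩
  refine (DFunLike.congr_fun hr.mfderiv v).trans
    (Eq.trans ?_ (DFunLike.congr_fun hf.mfderiv v).symm)
  simp only [modelWithCornersSelf_coe, range_id, fderivWithin_univ]
  exact DFunLike.congr_fun (hd.fderiv_restrictScalars ℝ) v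

end RestrictScalars

/-! ### Immersions have injective derivatives -/

section Immersion

variable {V : Type*} [NormedAddCommGroup V] [NormedSpace ℝ V]
  {M : Type*} [TopologicalSpace M] [ChartedSpace V M]
  {F : Type*} [NormedAddCommGroup F] [NormedSpace ℝ F]
  {L : Type*} [TopologicalSpace L] [ChartedSpace F L]

/-- The derivative of an immersion is injective. -/
theorem Manifold.IsImmersionAt.injective_mfderiv {ι : L → M} {x : L}
    (h : Manifold.IsImmersionAt 𝓘(ℝ, F) 𝓘(ℝ, V) ∞ ι x) :
    Function.Injective (mfderiv 𝓘(ℝ, F) 𝓘(ℝ, V) ι x) := by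
  have hmax := h.domChart_mem_maximalAtlas
  have hdom : h.domChart.MDifferentiable 𝓘(ℝ, F) 𝓘(ℝ, F) :=
    ⟨(contMDiffOn_of_mem_maximalAtlas hmax).mdifferentiableOn (by simp),
      (contMDiffOn_symm_of_mem_maximalAtlas hmax).mdifferentiableOn (by simp)⟩
  have hcod : MDifferentiableAt 𝓘(ℝ, V) 𝓘(ℝ, V) h.codChart (ι x) :=
    ((contMDiffOn_of_mem_maximalAtlas h.codChart_mem_maximalAtlas).mdifferentiableOn (by
        simp)).mdifferentiableAt
      (h.codChart.open_source.mem_nhds h.mem_codChart_source)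
  -- In suitable charts the immersion is v ↦ (v, 0). Projecting to the first factor recovers the
  -- chart of L, whose derivative is injective.
  let r : V → F := fun v => (h.equiv.symm v).1
  have hr : MDifferentiable 𝓘(ℝ, V) 𝓘(ℝ, F) r := by
    refine Differentiable.mdifferentiable ?_
    fun_prop
  have heq : h.domChart =ᶠ[𝓝 x] (r ∘ h.codChart) ∘ ι := by
    filter_upwards [h.domChart.open_source.mem_nhds h.mem_domChart_source] with y hy
    have h1 := h.writtenInCharts ((h.domChart.extend 𝓘(ℝ, F)).map_source (by simpa using hy))
    simp only [mfld_simps, Function.comp_apply] at h1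
    rw [h.domChart.left_inv hy] at h1
    simp only [Function.comp_apply, r, h1]
    simp
  have hι : MDifferentiableAt 𝓘(ℝ, F) 𝓘(ℝ, V) ι x := h.contMDiffAt.mdifferentiableAt (by simp)
  have hrc : MDifferentiableAt 𝓘(ℝ, V) 𝓘(ℝ, F) (r ∘ h.codChart) (ι x) := (hr _).comp _ hcod
  have hinj := hdom.mfderiv_injective h.mem_domChart_source
  rw [heq.mfderiv_eq, mfderiv_comp x hrc hι] at hinj
  exact Function.Injective.of_comp (f := mfderiv 𝓘(ℝ, V) 𝓘(ℝ, F) (r ∘ h.codChart) (ι x)) hinj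

end Immersion

/-! ### Tangent planes of a Lagrangian submanifold -/

section LagrangianTangent

variable {V : Type*} [NormedAddCommGroup V] [NormedSpace ℂ V]
  {M : Type*} [TopologicalSpace M] [ChartedSpace V M]
  {F : Type*} [NormedAddCommGroup F] [NormedSpace ℝ F]
  {L : Type*} [TopologicalSpace L] [ChartedSpace F L] {ι : L → M} {η : KahlerForm V M}

/-- The tangent planes of a Lagrangian submanifold are real subspaces of dimension `dim M`. -/
theorem IsLagrangian.exists_submodule_eq_tangentPlane (hι : IsLagrangian (F := F) η ι) {y : M}
    (hy : y ∈ range ι) :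
    ∃ T : Submodule ℝ V, Module.finrank ℝ T = Module.finrank ℂ V ∧
      ∀ v : V, v ∈ tangentPlane V F ι y ↔ v ∈ T := by
  obtain ⟨x, rfl⟩ := hy
  let D : F →ₗ[ℝ] V := (mfderiv 𝓘(ℝ, F) 𝓘(ℝ, V) ι x).toLinearMap
  have hD : Function.Injective D := (hι.isSmoothEmbedding.isImmersion.isImmersionAt
      x).injective_mfderiv
  refine ⟨LinearMap.range D, (LinearMap.finrank_range_of_inj hD).trans hι.finrank_eq, fun v => ?_⟩
  constructor
  · rintro ⟨⟨x', w⟩, hw⟩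
    -- Injectivity of the embedding ensures that only one tangent space of L maps into the fibre at
    -- y.
    obtain rfl : x' = x := hι.isSmoothEmbedding.isEmbedding.injective (congrArg
        Bundle.TotalSpace.proj hw)
    exact ⟨w, eq_of_heq (Bundle.TotalSpace.mk.inj hw).2⟩
  · rintro ⟨w, rfl⟩
    exact ⟨⟨x, w⟩, rfl⟩

theorem IsLagrangian.totallyReal (hι : IsLagrangian (F := F) η ι) {y : M} {v : TangentSpace 𝓘(ℂ, V)
    y}
    (hv : v ∈ tangentPlane V F ι y) (hv' : Complex.I • v ∈ tangentPlane V F ι y) : v = 0 := by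
  by_contra h
  exact (η.positive y v h).ne' (hι.isotropic y v hv _ hv')

/-- Real linearly independent vectors tangent to a Lagrangian are complex linearly independent. -/
theorem IsLagrangian.linearIndependent_complex (hι : IsLagrangian (F := F) η ι) {y : M}
    (hy : y ∈ range ι) {n : ℕ} {b : Fin n → V} (hb : LinearIndependent ℝ b)
    (hbT : ∀ j, b j ∈ tangentPlane V F ι y) : LinearIndependent ℂ b := by
  obtain ⟨T, -, hT⟩ := hι.exists_submodule_eq_tangentPlane hy
  exact linearIndependent_complex_of_totallyReal (T := T)
    (fun v hv hv' => hι.totallyReal ((hT v).2 hv) ((hT _).2 hv')) hb fun j => (hT _).1 (hbT j)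

theorem IsLagrangian.exists_real_basis [FiniteDimensional ℂ V] (hι : IsLagrangian (F := F) η ι) {y
    : M}
    (hy : y ∈ range ι) : ∃ b : Fin (Module.finrank ℂ V) → V,
      LinearIndependent ℝ b ∧ ∀ j, b j ∈ tangentPlane V F ι y := by
  obtain ⟨T, hn, hT⟩ := hι.exists_submodule_eq_tangentPlane hy
  have : FiniteDimensional ℝ V := FiniteDimensional.complexToReal V
  let b := Module.finBasisOfFinrankEq ℝ T hn
  exact ⟨fun j => b j, b.linearIndependent.map' T.subtype T.ker_subtype, fun j => (hT _).2 (b j).2⟩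

/-- The quotient `det² / |det|²` in the definition of the Maslov index does not depend on the real
basis of the tangent plane. -/
theorem IsLagrangian.sq_div_norm_sq_det_eq [FiniteDimensional ℂ V] (hι : IsLagrangian (F := F) η ι)
    {y : M} (hy : y ∈ range ι) {b b' : Fin (Module.finrank ℂ V) → V}
    (hb : LinearIndependent ℝ b) (hbT : ∀ j, b j ∈ tangentPlane V F ι y)
    (hb' : LinearIndependent ℝ b') (hbT' : ∀ j, b' j ∈ tangentPlane V F ι y)
    (e : Module.Basis (Fin (Module.finrank ℂ V)) ℂ (⊤ : Submodule ℂ V)) :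
    (e.det fun j => ⟨b' j, trivial⟩) ^ 2 / (‖e.det fun j => ⟨b' j, trivial⟩‖ : ℂ) ^ 2 =
      (e.det fun j => ⟨b j, trivial⟩) ^ 2 / (‖e.det fun j => ⟨b j, trivial⟩‖ : ℂ) ^ 2 := by
  obtain ⟨T, hn, hT⟩ := hι.exists_submodule_eq_tangentPlane hy
  obtain ⟨r, hr⟩ := exists_real_det_eq hn hb (fun j => (hT _).1 (hbT j)) (fun j => (hT _).1 (hbT'
      j)) e
  have h0 := det_ne_zero_of_linearIndependent e (hι.linearIndependent_complex hy hb' hbT')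
  rw [hr] at h0 ⊢
  exact sq_div_norm_sq_real_mul h0

/-- A symmetry of `M` which preserves a submanifold preserves its tangent planes. -/
theorem mfderiv_mem_tangentPlane [IsManifold 𝓘(ℂ, V) ω M] [IsManifold 𝓘(ℝ, F) ∞ L]
    (hι : Manifold.IsSmoothEmbedding 𝓘(ℝ, F) 𝓘(ℝ, V) ∞ ι) {f : M → M}
    (hf : ContMDiff 𝓘(ℂ, V) 𝓘(ℂ, V) ω f) (hfL : ∀ x, f (ι x) ∈ range ι) {y : M}
    {v : TangentSpace 𝓘(ℂ, V) y} (hv : v ∈ tangentPlane V F ι y) :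
    mfderiv 𝓘(ℂ, V) 𝓘(ℂ, V) f y v ∈ tangentPlane V F ι (f y) := by
  have : IsManifold 𝓘(ℂ, V) ∞ M := IsManifold.of_le (n := ω) (by simp)
  have : IsManifold 𝓘(ℝ, V) ∞ M := isManifold_real_of_complex
  have hfr : ContMDiff 𝓘(ℝ, V) 𝓘(ℝ, V) ∞ f := hf.restrictScalars_real.of_le (by simp)
  -- The map f lifts to g : L → L with ι ∘ g = f ∘ ι. It is continuous because ι is an embedding and
  -- smooth because ι is an immersion, so the chain rule applies to both sides.
  choose g hg using hfL
  have hg' : ι ∘ g = f ∘ ι := funext hg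
  have hgc : Continuous g := hι.isEmbedding.continuous_iff.2
    (hg' ▸ hfr.continuous.comp hι.contMDiff.continuous)
  have hgs : ContMDiff 𝓘(ℝ, F) 𝓘(ℝ, F) ∞ g :=
    (ContMDiff.iff_comp_isImmersion hι.isImmersion).2 ⟨hgc, hg' ▸ hfr.comp hι.contMDiff⟩
  obtain ⟨q, hq⟩ := hv
  refine ⟨tangentMap 𝓘(ℝ, F) 𝓘(ℝ, F) g q, ?_⟩
  have h1 : tangentMap 𝓘(ℝ, F) 𝓘(ℝ, V) ι (tangentMap 𝓘(ℝ, F) 𝓘(ℝ, F) g q) =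
      tangentMap 𝓘(ℝ, V) 𝓘(ℝ, V) f (tangentMap 𝓘(ℝ, F) 𝓘(ℝ, V) ι q) := by
    rw [← tangentMap_comp_at q (hfr.mdifferentiable (by simp) _) (hι.contMDiff.mdifferentiable (by
        simp) _),
      ← hg', tangentMap_comp_at q (hι.contMDiff.mdifferentiable (by simp) _) (hgs.mdifferentiable
          (by simp) _)]
  rw [h1, hq]
  exact congrArg (Bundle.TotalSpace.mk (F := V) (E := TangentSpace 𝓘(ℝ, V)) (f y))
    (mfderiv_real_eq (hf.mdifferentiable (by simp) y) v)

end LagrangianTangent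

/-! ### The Maslov index -/

section Maslov

theorem Module.Basis.det_mul_det_family {R N κ : Type*} [CommRing R] [AddCommGroup N] [Module R N]
    [Fintype κ] [DecidableEq κ] (a b : Module.Basis κ R N) (c : κ → N) :
    a.det b * b.det c = a.det c := by
  rw [Module.Basis.det_apply, Module.Basis.det_apply, Module.Basis.det_apply, ← Matrix.det_mul,
    Module.Basis.toMatrix_mul_toMatrix]

variable {V : Type*} [NormedAddCommGroup V] [NormedSpace ℂ V] [FiniteDimensional ℂ V]
  {M : Type*} [TopologicalSpace M] [ChartedSpace V M] [IsManifold 𝓘(ℂ, V) ω M]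
  {F : Type*} [NormedAddCommGroup F] [NormedSpace ℝ F]
  {L : Type*} [TopologicalSpace L] [ChartedSpace F L] {ι : L → M} {η : KahlerForm V M}

/-- A change of frame multiplies ρ by the normalized square of a determinant that has no zeros on
the disc, hence by a loop of winding number 0. Real bases of the tangent planes exist, so ρ is
determined by the frame. -/
theorem HasMaslovIndex.unique (hι : IsLagrangian (F := F) η ι) {u : C(ClosedDisc, M)} {k l : ℤ}
    (hk : HasMaslovIndex V F ι u k) (hl : HasMaslovIndex V F ι u l) : k = l := by
  obtain ⟨hL, a, ρ, hρ, hwk⟩ := hk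
  obtain ⟨-, a', ρ', hρ', hwl⟩ := hl
  have h := (hasWindingNumber_zero_of_disc (a'.continuous_det a)
    fun z => Module.Basis.det_basis_ne_zero _ _).sq_div_norm_sq.mul hwk
  rw [mul_zero, zero_add] at h
  refine HasWindingNumber.unique ?_ hwl
  convert h using 2 with z
  obtain ⟨b, hb, hbT⟩ : ∃ b : Fin (Module.finrank ℂ V) → TangentSpace 𝓘(ℂ, V) (u (bdry z)),
      LinearIndependent ℝ b ∧ ∀ j, b j ∈ tangentPlane V F ι (u (bdry z)) :=
    hι.exists_real_basis (hL z)
  rw [hρ z b hb hbT, hρ' z b hb hbT]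
  refine (congrArg (fun d : ℂ => d ^ 2 / (‖d‖ : ℂ) ^ 2) (Module.Basis.det_mul_det_family (a'.basis
      (bdry z))
    (a.basis (bdry z)) fun j => ⟨b j, trivial⟩).symm).trans ?_
  rw [norm_mul, Complex.ofReal_mul, mul_pow, mul_pow, mul_div_mul_comm]

theorem hasMaslovIndex_iff_of_exists (hι : IsLagrangian (F := F) η ι) {u : C(ClosedDisc, M)}
    (h : ∃ m, HasMaslovIndex V F ι u m) (m : ℤ) :
    HasMaslovIndex V F ι u m ↔ m = maslovIndex V F ι u := by
  have hc : HasMaslovIndex V F ι u (maslovIndex V F ι u) := by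
    rw [maslovIndex, dif_pos h]
    exact h.choose_spec
  exact ⟨fun hm => hm.unique hι hc, fun hm => hm ▸ hc⟩

/-- If the boundary of a disc is an orbit of the circle on an invariant Lagrangian, then its Maslov
index is twice the winding number of the determinant of the translates of a real basis. -/
theorem hasMaslovIndex_of_hasWindingNumber [MulAction ℂˣ M]
    [ContMDiffSMul 𝓘(ℂ, ℂ) 𝓘(ℂ, V) ω ℂˣ M] [IsManifold 𝓘(ℝ, F) ∞ L]
    (hι : IsLagrangian (F := F) η ι)
    (hL : ∀ (c : Circle) (x : L), Circle.toUnits c • ι x ∈ Set.range ι)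
    {u : C(ClosedDisc, M)} (hu : ∀ z : Circle, u (bdry z) = Circle.toUnits z • u (bdry 1))
    (huL : ∀ z, u (bdry z) ∈ range ι)
    (e : ComplexFrame 𝓘(ℂ, V) (fun _ : M => ⊤) (Module.finrank ℂ V) u)
    {b : Fin (Module.finrank ℂ V) → V} (hb : LinearIndependent ℝ b)
    (hbT : ∀ j, b j ∈ tangentPlane V F ι (u (bdry 1))) {k : ℤ}
    (hk : HasWindingNumber (fun z => (e.basis (bdry z)).det fun j =>
        ⟨mfderiv 𝓘(ℂ, V) 𝓘(ℂ, V) (fun y : M => Circle.toUnits z • y) (u (bdry 1)) (b j), trivial⟩)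
            k) :
    HasMaslovIndex V F ι u (2 * k) := by
  refine ⟨huL, e, _, fun z b' hb' hbT' => ?_, hk.sq_div_norm_sq⟩
  let D : V →ₗ[ℂ] V :=
    (mfderiv 𝓘(ℂ, V) 𝓘(ℂ, V) (fun y : M => Circle.toUnits z • y) (u (bdry 1))).toLinearMap
  have hD : Function.Injective D := injective_mfderiv_units_smul _ _
  have h1 : LinearIndependent ℝ fun j => D (b j) :=
    -- The translates of b are a real basis of the tangent plane at u(z); any other real basis gives
    -- the same normalized square.
    hb.map' (D.restrictScalars ℝ) (LinearMap.ker_eq_bot.2 hD)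
  have h2 : ∀ j, D (b j) ∈ tangentPlane V F ι (u (bdry z)) := fun j => by
    rw [hu z]
    exact mfderiv_mem_tangentPlane hι.isSmoothEmbedding (ContMDiffSMul.contMDiff_const_smul (I :=
        𝓘(ℂ, ℂ)) _) (hL z) (hbT j)
  exact hι.sq_div_norm_sq_det_eq (huL z) hb' hbT' h1 h2 (e.basis (bdry z))

end Maslov

/-! ### The index formula -/

theorem mainTheorem9 {V : Type*} [NormedAddCommGroup V] [NormedSpace ℂ V] [FiniteDimensional ℂ V]
    {M : Type*} [TopologicalSpace M] [T2Space M] [SecondCountableTopology M]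
    [ChartedSpace V M] [IsManifold 𝓘(ℂ, V) ω M]
    [MulAction ℂˣ M] [ContinuousSMul ℂˣ M] [ContMDiffSMul 𝓘(ℂ, ℂ) 𝓘(ℂ, V) ω ℂˣ M]
    (Ω : KahlerForm V M) (hΩ : Ω.IsCircleInvariant)
    {F : Type*} [NormedAddCommGroup F] [NormedSpace ℝ F] [FiniteDimensional ℝ F]
    {L : Type*} [TopologicalSpace L] [ChartedSpace F L] [IsManifold 𝓘(ℝ, F) ∞ L]
    (ι : L → M) (hι : IsLagrangian (F := F) Ω ι)
    (hL : ∀ (c : Circle) (x : L), Circle.toUnits c • ι x ∈ Set.range ι)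
    (u : C(ClosedDisc, M))
    (hu : ∀ z : Circle, u (bdry z) = Circle.toUnits z • u (bdry 1))
    (hu₁ : u (bdry 1) ∈ Set.range ι) :
    (∀ z : Circle, u (bdry z) ∈ Set.range ι) ∧
    (Continuous (AssocBundle.discSection u) ∧
      ∀ p, AssocBundle.proj (AssocBundle.discSection u p) = p) ∧
    (∀ m : ℤ, HasMaslovIndex V F ι u m ↔ m = maslovIndex V F ι u) ∧
    (∀ k : ℤ, HasChernNumber (𝓘(ℂ, V).prod 𝓘(ℂ, ℂ)) (AssocBundle.vertical V)
        (Module.finrank ℂ V) (AssocBundle.discSection u) k ↔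
      k = chernNumber (𝓘(ℂ, V).prod 𝓘(ℂ, ℂ)) (AssocBundle.vertical V)
        (Module.finrank ℂ V) (AssocBundle.discSection u)) ∧
    maslovIndex V F ι u =
      2 * chernNumber (𝓘(ℂ, V).prod 𝓘(ℂ, ℂ)) (AssocBundle.vertical V)
        (Module.finrank ℂ V) (AssocBundle.discSection u) := by
  have huL : ∀ z : Circle, u (bdry z) ∈ Set.range ι := fun z => by
    obtain ⟨x, hx⟩ := hu₁
    rw [hu z, ← hx]
    exact hL z x
  obtain ⟨e⟩ := exists_complexFrame_disc (V := V) u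
  obtain ⟨b, hb, hbT⟩ := hι.exists_real_basis hu₁
  have hbc := hι.linearIndependent_complex hu₁ hb hbT
  -- The real basis b of the tangent plane of L, being complex independent, serves as the complex
  -- basis here; the same winding number k then enters the Maslov index.
  obtain ⟨k, hk, hw⟩ := exists_hasChernNumber_discSection u hu e
    (Module.Basis.mk hbc (hbc.span_eq_top_of_card_eq_finrank' (by simp)).ge)
  simp only [Module.Basis.mk_apply] at hw
  have hm := hasMaslovIndex_of_hasWindingNumber hι hL hu huL e hb hbT hw
  have hM := hasMaslovIndex_iff_of_exists hι ⟨_, hm⟩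
  have hC := hasChernNumber_iff_of_exists ⟨_, hk⟩
  refine ⟨huL, ⟨AssocBundle.continuous_discSection u hu, AssocBundle.proj_discSection u⟩, hM, hC,
      ?_⟩
  rw [← (hM _).1 hm, ← (hC _).1 hk]

end
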